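/- \textbf{Theorem (Prediction Rule).} Let $\Omega$ be a measurable space whose points are separated by countably many measurable sets, let $G_0$ be a finite measure on $\Omega$ giving mass zero to every point, let $\gamma_0=G_0(\Omega)$, and let $\rho$ be a measure on $\mathbb{R}_+=[0,\infty)$ with $\iint_{\mathbb{R}_+\times\Omega}\min\{1,r\}\,\rho(dr)G_0(d\omega)<\infty$. Consider the count-mixture model with scale parameter $1$: (i) $G=\sum_{k=1}^{K}r_k\delta_{\omega_k}$, $K\le\infty$, with distinct random atoms $\omega_k\in\Omega$ of weights $r_k>0$, is a random measure with $G(\Omega)<\infty$ a.s., such that $G(A_1),\dots,G(A_N)$ are independent for pairwise disjoint measurable $A_1,\dots,A_N$ and, for every measurable $A\subset\Omega$ and $u\in\mathbb{R}$, $$\mathbb{E}\big[e^{iuG(A)}\big]=\exp\Big\{\iint_{\mathbb{R}_+\times A}(e^{iur}-1)\,\rho(dr)G_0(d\omega)\Big\},$$ i.e. $G$ is a homogeneous completely random measure with Lévy measure $\rho(dr)G_0(d\omega)$; (ii) given the atoms and weights, $m\sim\mathrm{Pois}(G(\Omega))$ and, given also $m$, the labels $z_1,\dots,z_m$ are i.i.d.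 with law $\sum_{k=1}^K\frac{r_k}{G(\Omega)}\delta_k$ (if $G(\Omega)=0$ then $m=0$). Two data points are in the same cluster if and only if their labels agree. Fix a sample size $m\ge 1$ and an index $i\in\{1,\dots,m\}$. Let $\boldsymbol z^{-i}$ denote the labels of the other $m-1$ data points, relabelled $1,2,\dots,l^{-i}$ in order of appearance among these points, where $l^{-i}$ is the number of their clusters, and let $n_k^{-i}\ge 1$ be the number of points $j\ne i$ in cluster $k$. Write $z_i=k\le l^{-i}$ if point $i$ belongs to cluster $k$, and $z_i=l^{-i}+1$ if it shares its cluster with no other point. Put $$w_k=\begin{cases}\dfrac{\int_0^\infty r^{\,n_k^{-i}+1}e^{-r}\rho(dr)}{\int_0^\infty r^{\,n_k^{-i}}e^{-r}\rho(dr)}, & k=1,\dots,l^{-i},\\[3mm] \gamma_0\displaystyle\int_0^\infty re^{-r}\rho(dr), & k=l^{-i}+1.\end{cases}$$ Then for every value of $\boldsymbol z^{-i}$ that has positive probability jointly with the sample size $m$, all $w_k$ are positive and finite, and $$P(z_i=k\mid\boldsymbol z^{-i},m,\gamma_0,\rho)=\frac{w_k}{\sum_{k'=1}^{l^{-i}+1}w_{k'}},\qquad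 k=1,\dots,l^{-i}+1,$$ that is, $P(z_i=k\mid\boldsymbol z^{-i},m,\gamma_0,\rho)\propto w_k$. -/

import Mathlib

open MeasureTheory ProbabilityTheory
open scoped NNReal ENNReal

namespace CountMixture

variable {S Ω : Type*} [MeasurableSpace S] [MeasurableSpace Ω]

/-- `G` is a completely random measure on `Ω`, over the probability space `(S, P)`, with Lévy
measure `ν` on `ℝ₊ × Ω`: `∫∫ min(1, r) ν(dr dω) < ∞`, `G` is a.s. finite, the masses of pairwise
disjoint measurable sets are independent, and
`E[exp(i u G(A))] = exp(∫∫_{ℝ₊ × A} (exp(i u r) - 1) ν(dr dω))`. -/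
structure IsCompletelyRandomMeasure (ν : Measure (ℝ≥0 × Ω)) (P : Measure S)
    (G : S → Measure Ω) : Prop where
  measurable : Measurable G
  finite : ∀ᵐ s ∂P, G s Set.univ < ∞
  levy : ∫⁻ p, ((min 1 p.1 : ℝ≥0) : ℝ≥0∞) ∂ν < ∞
  indep : ∀ (N : ℕ) (A : Fin N → Set Ω), (∀ j, MeasurableSet (A j)) →
    Pairwise (fun i j => Disjoint (A i) (A j)) → iIndepFun (fun j s => G s (A j)) P
  charFun : ∀ A : Set Ω, MeasurableSet A → ∀ u : ℝ,
    ∫ s, Complex.exp (Complex.I * u * ((G s A).toReal : ℂ)) ∂P =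
      Complex.exp (∫ p in Set.univ ×ˢ A, (Complex.exp (Complex.I * u * ((p.1 : ℝ) : ℂ)) - 1) ∂ν)

/-- The random discrete measure `G = ∑ₖ rₖ δ_{ωₖ}` with weights `r k` and atoms `loc k`.  Finitely
many atoms are covered by letting all but finitely many weights vanish. -/
noncomputable def atomicMeasure (r : ℕ → S → ℝ≥0) (loc : ℕ → S → Ω) (s : S) : Measure Ω :=
  Measure.sum fun k => (r k s : ℝ≥0∞) • Measure.dirac (loc k s)

/-- The total random mass `G(Ω)`. -/
noncomputable def totalMass (r : ℕ → S → ℝ≥0) (loc : ℕ → S → Ω) (s : S) : ℝ≥0 :=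
  (atomicMeasure r loc s Set.univ).toNNReal

/-- The sigma-algebra generated by all weights and atoms of `G`. -/
abbrev atomSigma (r : ℕ → S → ℝ≥0) (loc : ℕ → S → Ω) : MeasurableSpace S :=
  MeasurableSpace.comap (fun s k => (r k s, loc k s)) inferInstance

/-- The count-mixture model (with scale parameter `β = 1`).
`G = ∑ₖ rₖ δ_{ωₖ}`, with distinct atoms, is a homogeneous completely random measure with Lévy
measure `ρ(dr) G₀(dω)`; given `G`, the sample size `m` is `Pois(G(Ω))` distributed and, given `G`
and `m`, the labels `z 0, …, z (m - 1)` of the `m` data points are independent with law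
`∑ₖ (rₖ / G(Ω)) δₖ`.  The entries `z i` with `i ≥ m` play no role. -/
structure IsCountMixture (ρ : Measure ℝ≥0) (G₀ : Measure Ω) (P : Measure S)
    (r : ℕ → S → ℝ≥0) (loc : ℕ → S → Ω) (m : S → ℕ) (z : ℕ → S → ℕ) : Prop where
  measurable_weight : ∀ k, Measurable (r k)
  measurable_loc : ∀ k, Measurable (loc k)
  measurable_size : Measurable m
  measurable_label : ∀ i, Measurable (z i)
  distinct : ∀ᵐ s ∂P, ∀ j k, 0 < r j s → 0 < r k s → loc j s = loc k s → j = k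
  crm : IsCompletelyRandomMeasure (ρ.prod G₀) P (atomicMeasure r loc)
  condLaw : ∀ (n : ℕ) (c : Fin n → ℕ),
    P⟦{s | m s = n ∧ ∀ i : Fin n, z i s = c i} | atomSigma r loc⟧ =ᵐ[P]
      fun s => (poissonMeasure (totalMass r loc s)).real {n} *
        ∏ i, (r (c i) s : ℝ) / (totalMass r loc s : ℝ)

/-- Relabelling of a label vector in order of appearance, starting from `1`: the new label of
position `i` is the number of distinct values of `c` up to the first occurrence of `c i`. -/
def appearanceLabel {n : ℕ} (c : Fin n → ℕ) (i : Fin n) : ℕ :=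
  ((Finset.univ.filter fun j => ∀ i', c i' = c i → j ≤ i').image c).card

/-- `z^{-i}`: the labels of the elements other than `i`, clusters being numbered `1, 2, …` in order
of appearance among these elements. -/
def labelsWithout {n : ℕ} (i : Fin (n + 1)) (c : Fin (n + 1) → ℕ) : Fin n → ℕ :=
  appearanceLabel (i.removeNth c)

/-- The label of element `i` relative to `labelsWithout i c`: it is `k` if `i` belongs to the
cluster numbered `k` there, and one more than the number of clusters there if `i` shares its
cluster with no other element.  (Relabelling by appearance with `i` visited last.) -/
def labelOf {n : ℕ} (i : Fin (n + 1)) (c : Fin (n + 1) → ℕ) : ℕ :=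
  appearanceLabel (Fin.snoc (α := fun _ => ℕ) (i.removeNth c) (c i)) (Fin.last n)

/-- The number of clusters in a label vector. -/
def numClusters {n : ℕ} (y : Fin n → ℕ) : ℕ := (Finset.univ.image y).card

/-- The size of cluster `k` in a label vector. -/
def clusterSize {n : ℕ} (y : Fin n → ℕ) (k : ℕ) : ℕ := (Finset.univ.filter fun j => y j = k).card

/-- `∫ r^n e^{-r} ρ(dr)`. -/
noncomputable def tiltedMoment (ρ : Measure ℝ≥0) (n : ℕ) : ℝ :=
  ∫ r, (r : ℝ) ^ n * Real.exp (-(r : ℝ)) ∂ρ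

/-- The unnormalised weight of label `k` in the prediction rule, given the labels `y` of the other
elements: an existing cluster if `k ≤ numClusters y`, a new cluster otherwise. -/
noncomputable def predictionWeight (γ₀ : ℝ) (ρ : Measure ℝ≥0) {n : ℕ} (y : Fin n → ℕ) (k : ℕ) :
    ℝ :=
  if k ≤ numClusters y then
    tiltedMoment ρ (clusterSize y k + 1) / tiltedMoment ρ (clusterSize y k)
  else γ₀ * tiltedMoment ρ 1

end CountMixture

/-
A partition of the index set is recorded as the kernel of a labelling. Since `m` is Poisson and the
labels are i.i.d. given `G`, the probability that `m = n` and the labels induce a given partition is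
`1/n! * E[e^{-G(Ω)} G^{⊗n}(A)]`, where `A` is the set of points of `Ω^n` inducing that partition.
Cut `Ω` into finitely many cells and approximate `A` by a union of products of cells. The masses of
the cells are independent, so each product contributes a product of tilted moments
`E[G(B)^j e^{-G(B)}]`. The characteristic function of `G(B)` continues analytically to
`E[e^{z G(B)}] = exp (G₀(B) ∫ (e^{zr} - 1) ρ(dr))` for `re z ≤ 0`, and differentiating at `z = -1`
shows that the tilted moment is `E[e^{-G(B)}]` times the complete Bell polynomial in
`G₀(B) κ_1, G₀(B) κ_2, …`, where `κ_j = ∫ r^j e^{-r} ρ(dr)`. Because `G₀` has no atoms, only the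
linear terms `G₀(B) κ_j` survive when the cells shrink to points: up to a factor depending on `n`
only, the partition has probability `∏ γ₀ κ_{|c|}` over its clusters `c`. Adding an element to
cluster `k` multiplies this product by `w_k`.
-/

open Filter Topology

namespace CountMixture

section Labels

lemma ker_eq_ker_iff {ι α β : Type*} {c : ι → α} {q : ι → β} :
    Setoid.ker c = Setoid.ker q ↔ ∀ i j, c i = c j ↔ q i = q j :=
  Setoid.ext_iff

lemma card_image_le_of_ker_eq_ker {ι α β : Type*} [DecidableEq α] [DecidableEq β] {c : ι → α}
    {q : ι → β} (h : Setoid.ker c = Setoid.ker q) (s : Finset ι) :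
    (s.image q).card ≤ (s.image c).card := by
  rcases isEmpty_or_nonempty ι with _ | ⟨⟨i⟩⟩
  · simp [Finset.eq_empty_of_isEmpty s]
  · have : Nonempty β := ⟨q i⟩
    obtain ⟨g, rfl⟩ : ∃ g : α → β, q = g ∘ c :=
      (Function.factorsThrough_iff q).1 fun i j => (ker_eq_ker_iff.1 h i j).1
    rw [← Finset.image_image]
    exact Finset.card_image_le

lemma card_image_eq_of_ker_eq_ker {ι α β : Type*} [DecidableEq α] [DecidableEq β] {c : ι → α}
    {q : ι → β} (h : Setoid.ker c = Setoid.ker q) (s : Finset ι) :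
    (s.image c).card = (s.image q).card :=
  le_antisymm (card_image_le_of_ker_eq_ker h.symm s) (card_image_le_of_ker_eq_ker h s)

variable {n : ℕ}

lemma appearanceLabel_eq_of_ker_eq_ker {c q : Fin n → ℕ} (h : Setoid.ker c = Setoid.ker q) :
    appearanceLabel c = appearanceLabel q := by
  funext i
  rw [appearanceLabel, appearanceLabel, card_image_eq_of_ker_eq_ker h]
  simp only [ker_eq_ker_iff.1 h]

lemma exists_first_occurrence (c : Fin n → ℕ) (i : Fin n) :
    ∃ a, c a = c i ∧ ∀ j, c j = c i → a ≤ j := by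
  have hne : (Finset.univ.filter fun j => c j = c i).Nonempty := ⟨i, by simp⟩
  refine ⟨_, (Finset.mem_filter.1 (Finset.min'_mem _ hne)).2, fun j hj => ?_⟩
  exact Finset.min'_le _ _ (by simpa using hj)

lemma appearanceLabel_lt {c : Fin n → ℕ} {i j a b : Fin n} (ha : c a = c i) (hb : c b = c j)
    (hb_first : ∀ j', c j' = c j → b ≤ j') (hab : a < b) :
    appearanceLabel c i < appearanceLabel c j := by
  refine Finset.card_lt_card (Finset.ssubset_iff_of_subset (Finset.image_subset_image ?_) |>.2 ?_)
  · intro k hk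
    simp only [Finset.mem_filter, Finset.mem_univ, true_and] at hk ⊢
    exact fun i' hi' => (hk a ha).trans (hab.le.trans (hb_first i' hi'))
  · refine ⟨c b, Finset.mem_image_of_mem c (by simpa [hb] using hb_first), ?_⟩
    simp only [Finset.mem_image, Finset.mem_filter, Finset.mem_univ, true_and, not_exists,
      not_and]
    exact fun k hk hkb => ((hk a ha).trans_lt hab).not_ge (hb_first k (hkb.trans hb))

lemma ker_appearanceLabel (c : Fin n → ℕ) : Setoid.ker (appearanceLabel c) = Setoid.ker c := by
  refine ker_eq_ker_iff.2 fun i j => ⟨fun h => ?_, fun h => by simp only [appearanceLabel, h]⟩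
  obtain ⟨a, ha, ha'⟩ := exists_first_occurrence c i
  obtain ⟨b, hb, hb'⟩ := exists_first_occurrence c j
  rcases lt_trichotomy a b with hab | rfl | hab
  · exact absurd h (appearanceLabel_lt ha hb hb' hab).ne
  · rw [← ha, hb]
  · exact absurd h (appearanceLabel_lt hb ha ha' hab).ne'

lemma appearanceLabel_appearanceLabel (c : Fin n → ℕ) :
    appearanceLabel (appearanceLabel c) = appearanceLabel c :=
  appearanceLabel_eq_of_ker_eq_ker (ker_appearanceLabel c)

lemma appearanceLabel_mem_Icc (c : Fin n → ℕ) (i : Fin n) :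
    appearanceLabel c i ∈ Finset.Icc 1 (numClusters c) := by
  obtain ⟨a, -, ha⟩ := exists_first_occurrence c i
  refine Finset.mem_Icc.2 ⟨?_, Finset.card_le_card
    (Finset.image_subset_image (Finset.filter_subset _ _))⟩
  exact Finset.card_pos.2 ⟨c a, Finset.mem_image_of_mem c (by simpa using ha)⟩

lemma image_appearanceLabel (c : Fin n → ℕ) :
    Finset.univ.image (appearanceLabel c) = Finset.Icc 1 (numClusters c) := by
  refine Finset.eq_of_subset_of_card_le
    (Finset.image_subset_iff.2 fun i _ => appearanceLabel_mem_Icc c i) ?_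
  simp [card_image_eq_of_ker_eq_ker (ker_appearanceLabel c), numClusters]

lemma numClusters_appearanceLabel (c : Fin n → ℕ) :
    numClusters (appearanceLabel c) = numClusters c :=
  card_image_eq_of_ker_eq_ker (ker_appearanceLabel c) _

lemma appearanceLabel_snoc_castSucc (c : Fin n → ℕ) (x : ℕ) (j : Fin n) :
    appearanceLabel (Fin.snoc (α := fun _ => ℕ) c x) j.castSucc = appearanceLabel c j := by
  have first_positions : (Finset.univ.filter fun a : Fin (n + 1) =>
      ∀ i', Fin.snoc (α := fun _ => ℕ) c x i' = c j → a ≤ i') =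
      (Finset.univ.filter fun a : Fin n => ∀ i', c i' = c j → a ≤ i').image Fin.castSucc := by
    ext a
    simp only [Finset.mem_filter, Finset.mem_univ, true_and, Finset.mem_image]
    constructor
    · intro h
      obtain ⟨a, rfl⟩ : ∃ b : Fin n, b.castSucc = a := Fin.exists_castSucc_eq.2
        ((h j.castSucc (by simp)).trans_lt (Fin.castSucc_lt_last j)).ne
      exact ⟨a, fun i' hi' => Fin.castSucc_le_castSucc_iff.1 (h i'.castSucc (by simpa)), rfl⟩
    · rintro ⟨a, ha, rfl⟩ i' hi'
      induction i' using Fin.lastCases with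
      | last => exact Fin.le_last _
      | cast i' => exact Fin.castSucc_le_castSucc_iff.2 (ha i' (by simpa using hi'))
  have comp_castSucc : Fin.snoc (α := fun _ => ℕ) c x ∘ Fin.castSucc = c := by
    funext k
    simp
  rw [appearanceLabel, Fin.snoc_castSucc, first_positions, Finset.image_image, comp_castSucc,
    appearanceLabel]

lemma numClusters_snoc_le (c : Fin n → ℕ) (x : ℕ) :
    numClusters (Fin.snoc (α := fun _ => ℕ) c x) ≤ numClusters c + 1 := by
  have : Finset.univ.image (Fin.snoc (α := fun _ => ℕ) c x) ⊆
      insert x (Finset.univ.image c) := by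
    refine Finset.image_subset_iff.2 fun i _ => ?_
    induction i using Fin.lastCases with
    | last => simp
    | cast i => simp
  exact (Finset.card_le_card this).trans (Finset.card_insert_le _ _)

lemma appearanceLabel_snoc_last_mem_Icc (c : Fin n → ℕ) (x : ℕ) :
    appearanceLabel (Fin.snoc (α := fun _ => ℕ) c x) (Fin.last n) ∈
      Finset.Icc 1 (numClusters c + 1) :=
  Finset.Icc_subset_Icc_right (numClusters_snoc_le c x) (appearanceLabel_mem_Icc _ _)

lemma appearanceLabel_snoc_last_eq_iff (c : Fin n → ℕ) (x : ℕ) (j : Fin n) :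
    appearanceLabel (Fin.snoc (α := fun _ => ℕ) c x) (Fin.last n) = appearanceLabel c j ↔
      x = c j := by
  rw [← appearanceLabel_snoc_castSucc c x j]
  simpa using
    ker_eq_ker_iff.1 (ker_appearanceLabel (Fin.snoc (α := fun _ => ℕ) c x)) (Fin.last n) j.castSucc

lemma appearanceLabel_snoc_last {y : Fin n → ℕ} (hy : appearanceLabel y = y) {k : ℕ}
    (hk : k ∈ Finset.Icc 1 (numClusters y + 1)) :
    appearanceLabel (Fin.snoc (α := fun _ => ℕ) y k) (Fin.last n) = k := by
  have image_y : Finset.univ.image y = Finset.Icc 1 (numClusters y) := by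
    conv_lhs => rw [← hy]
    exact image_appearanceLabel y
  have last_eq_iff := appearanceLabel_snoc_last_eq_iff y k
  rw [hy] at last_eq_iff
  by_cases hky : ∃ j, k = y j
  · obtain ⟨j, hj⟩ := hky
    rw [(last_eq_iff j).2 hj, hj]
  · have not_mem {v : ℕ} (hv : ∀ j, v ≠ y j) : v ∉ Finset.Icc 1 (numClusters y) := by
      simpa [← image_y, eq_comm] using hv
    push Not at hky
    have hk_new := not_mem hky
    have last_new := not_mem fun j => mt (last_eq_iff j).1 (hky j)
    have last_mem := appearanceLabel_snoc_last_mem_Icc y k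
    simp only [Finset.mem_Icc] at hk hk_new last_new last_mem
    omega

lemma appearanceLabel_labelsWithout (i : Fin (n + 1)) (c : Fin (n + 1) → ℕ) :
    appearanceLabel (labelsWithout i c) = labelsWithout i c :=
  appearanceLabel_appearanceLabel _

lemma labelOf_mem_Icc (i : Fin (n + 1)) (c : Fin (n + 1) → ℕ) :
    labelOf i c ∈ Finset.Icc 1 (numClusters (labelsWithout i c) + 1) := by
  rw [labelsWithout, numClusters_appearanceLabel]
  exact appearanceLabel_snoc_last_mem_Icc _ _

lemma ker_eq_ker_insertNth_iff {i : Fin (n + 1)} {c : Fin (n + 1) → ℕ} {k : ℕ} {y : Fin n → ℕ} :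
    Setoid.ker c = Setoid.ker (i.insertNth (α := fun _ => ℕ) k y) ↔
      Setoid.ker (i.removeNth c) = Setoid.ker y ∧ ∀ j, c i = i.removeNth c j ↔ k = y j := by
  simp only [ker_eq_ker_iff, Fin.forall_iff_succAbove i, Fin.insertNth_apply_same,
    Fin.insertNth_apply_succAbove, Fin.removeNth]
  grind

lemma ker_snoc_removeNth {i : Fin (n + 1)} {c q : Fin (n + 1) → ℕ}
    (h : Setoid.ker c = Setoid.ker q) :
    Setoid.ker (Fin.snoc (α := fun _ => ℕ) (i.removeNth c) (c i)) =
      Setoid.ker (Fin.snoc (α := fun _ => ℕ) (i.removeNth q) (q i)) := by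
  simp only [ker_eq_ker_iff] at h ⊢
  simp [Fin.forall_fin_succ', Fin.removeNth, h]

lemma labelsWithout_eq_and_labelOf_eq_iff {i : Fin (n + 1)} {c : Fin (n + 1) → ℕ} {y : Fin n → ℕ}
    (hy : appearanceLabel y = y) {k : ℕ} (hk : k ∈ Finset.Icc 1 (numClusters y + 1)) :
    labelsWithout i c = y ∧ labelOf i c = k ↔
      Setoid.ker c = Setoid.ker (i.insertNth (α := fun _ => ℕ) k y) := by
  constructor
  · rintro ⟨rfl, rfl⟩
    exact ker_eq_ker_insertNth_iff.2
      ⟨(ker_appearanceLabel _).symm, fun j => (appearanceLabel_snoc_last_eq_iff _ _ j).symm⟩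
  · intro h
    have labels_congr : labelsWithout i c = appearanceLabel y :=
      appearanceLabel_eq_of_ker_eq_ker (ker_eq_ker_insertNth_iff.1 h).1
    have label_congr := congrFun (appearanceLabel_eq_of_ker_eq_ker (ker_snoc_removeNth (i := i) h))
      (Fin.last n)
    rw [Fin.removeNth_insertNth, Fin.insertNth_apply_same] at label_congr
    exact ⟨labels_congr.trans hy, label_congr.trans (appearanceLabel_snoc_last hy hk)⟩

lemma clusterSize_insertNth (i : Fin (n + 1)) (k : ℕ) (y : Fin n → ℕ) (v : ℕ) :
    clusterSize (i.insertNth (α := fun _ => ℕ) k y) v =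
      clusterSize y v + if k = v then 1 else 0 := by
  simp only [clusterSize, Finset.card_filter]
  rw [Fin.sum_univ_succAbove _ i, add_comm]
  simp

lemma image_insertNth (i : Fin (n + 1)) (k : ℕ) (y : Fin n → ℕ) :
    Finset.univ.image (i.insertNth (α := fun _ => ℕ) k y) = insert k (Finset.univ.image y) := by
  ext v
  simp only [Finset.mem_image, Finset.mem_univ, true_and, Finset.mem_insert]
  rw [Fin.exists_iff_succAbove i]
  simp [eq_comm]

lemma clusterSize_pos {q : Fin n → ℕ} {v : ℕ} (hv : v ∈ Finset.univ.image q) :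
    0 < clusterSize q v := by
  obtain ⟨i, -, hi⟩ := Finset.mem_image.1 hv
  exact Finset.card_pos.2 ⟨i, by simpa using hi⟩

end Labels

section LevyExponent

/-- The exponent `∫ (e^{zr} - 1) ν(dr)` of the moment generating function of an infinitely
divisible law on `ℝ₊` with Lévy measure `ν`; it is meaningful for `re z ≤ 0`. -/
noncomputable def levyExponent (ν : Measure ℝ≥0) (z : ℂ) : ℂ :=
  ∫ r, (Complex.exp (z * (r : ℝ)) - 1) ∂ν

/-- The size-biased measure `r ν(dr)`. Its moment generating function is the derivative of the Lévy
exponent of `ν`. -/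
noncomputable def sizeBiased (ν : Measure ℝ≥0) : Measure ℝ≥0 :=
  ν.withDensity fun r => (r : ℝ≥0∞)

lemma norm_cexp_mul_le_one {z : ℂ} (hz : z.re ≤ 0) {x : ℝ} (hx : 0 ≤ x) :
    ‖Complex.exp (z * x)‖ ≤ 1 := by
  simpa [Complex.norm_exp] using mul_nonpos_of_nonpos_of_nonneg hz hx

lemma norm_cexp_mul_sub_one_le {z : ℂ} (hz : z.re ≤ 0) {x : ℝ} (hx : 0 ≤ x) :
    ‖Complex.exp (z * x) - 1‖ ≤ 2 * (1 + ‖z‖) * min 1 x := by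
  have norm_le_two : ‖Complex.exp (z * x) - 1‖ ≤ 2 := by
    calc ‖Complex.exp (z * x) - 1‖ ≤ ‖Complex.exp (z * x)‖ + ‖(1 : ℂ)‖ := norm_sub_le _ _
      _ ≤ 2 := by rw [norm_one]; linarith [norm_cexp_mul_le_one hz hx]
  have norm_le_of_mul_le (h : ‖z‖ * x ≤ 1) : ‖Complex.exp (z * x) - 1‖ ≤ 2 * (‖z‖ * x) := by
    simpa [abs_of_nonneg hx] using
      Complex.norm_exp_sub_one_le (x := z * x) (by simpa [abs_of_nonneg hx] using h)
  rcases le_total 1 x with h | h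
  · rw [min_eq_left h]
    nlinarith [norm_nonneg z]
  · rw [min_eq_right h]
    rcases le_total 1 (‖z‖ * x) with h' | h'
    · nlinarith
    · nlinarith [norm_le_of_mul_le h']

lemma mul_exp_mul_le {t : ℝ} (ht : t < 0) {x : ℝ} (hx : 0 ≤ x) :
    x * Real.exp (t * x) ≤ max 1 (-t)⁻¹ * min 1 x := by
  rcases le_total 1 x with h | h
  · rw [min_eq_left h, mul_one]
    refine le_max_of_le_right ?_
    rw [← mul_one (-t)⁻¹, le_inv_mul_iff₀ (neg_pos.2 ht)]
    calc -t * (x * Real.exp (t * x)) = -t * x * Real.exp (t * x) := by ring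
      _ ≤ Real.exp (-t * x) * Real.exp (t * x) := by
          gcongr
          linarith [Real.add_one_le_exp (-t * x)]
      _ = 1 := by rw [← Real.exp_add]; simp
  · rw [min_eq_right h, mul_comm]
    gcongr
    exact (Real.exp_le_one_iff.2 (mul_nonpos_of_nonpos_of_nonneg ht.le hx)).trans (le_max_left _ _)

variable {ν : Measure ℝ≥0}

lemma integrable_cexp_mul_sub_one (hν : Integrable (fun r : ℝ≥0 => min 1 (r : ℝ)) ν) {z : ℂ}
    (hz : z.re ≤ 0) : Integrable (fun r : ℝ≥0 => Complex.exp (z * (r : ℝ)) - 1) ν :=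
  (hν.const_mul (2 * (1 + ‖z‖))).mono' (by fun_prop)
    (ae_of_all _ fun r => norm_cexp_mul_sub_one_le hz r.2)

lemma integrable_mul_exp_mul (hν : Integrable (fun r : ℝ≥0 => min 1 (r : ℝ)) ν) {t : ℝ}
    (ht : t < 0) : Integrable (fun r : ℝ≥0 => (r : ℝ) * Real.exp (t * r)) ν :=
  (hν.const_mul (max 1 (-t)⁻¹)).mono' (by fun_prop) (ae_of_all _ fun r => by
    rw [Real.norm_of_nonneg (by positivity)]
    exact mul_exp_mul_le ht r.2)

lemma Iio_subset_interior_integrableExpSet_sizeBiased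
    (hν : Integrable (fun r : ℝ≥0 => min 1 (r : ℝ)) ν) :
    Set.Iio 0 ⊆ interior (integrableExpSet (fun r : ℝ≥0 => (r : ℝ)) (sizeBiased ν)) := by
  refine interior_maximal (fun t ht => ?_) isOpen_Iio
  refine (integrable_withDensity_iff_integrable_smul measurable_id).2 ?_
  exact integrable_mul_exp_mul hν ht

lemma Iio_subset_interior_integrableExpSet {S : Type*} [MeasurableSpace S] {P : Measure S}
    [IsFiniteMeasure P] {X : S → ℝ} (hX : AEMeasurable X P) (hX_nonneg : ∀ s, 0 ≤ X s) :
    Set.Iio 0 ⊆ interior (integrableExpSet X P) := by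
  refine interior_maximal (fun t ht => ?_) isOpen_Iio
  refine Integrable.of_bound (by fun_prop) 1 (ae_of_all _ fun s => ?_)
  rw [Real.norm_of_nonneg (Real.exp_pos _).le, Real.exp_le_one_iff]
  exact mul_nonpos_of_nonpos_of_nonneg (le_of_lt ht) (hX_nonneg s)

lemma hasDerivAt_levyExponent (hν : Integrable (fun r : ℝ≥0 => min 1 (r : ℝ)) ν) {z : ℂ}
    (hz : z.re < 0) :
    HasDerivAt (levyExponent ν) (complexMGF (fun r : ℝ≥0 => (r : ℝ)) (sizeBiased ν) z) z := by
  have half_plane_mem : {w : ℂ | w.re < z.re / 2} ∈ 𝓝 z :=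
    (isOpen_lt Complex.continuous_re continuous_const).mem_nhds (by simp; linarith)
  have hderiv := (hasDerivAt_integral_of_dominated_loc_of_deriv_le
    (F := fun z (r : ℝ≥0) => Complex.exp (z * (r : ℝ)) - 1)
    (F' := fun z (r : ℝ≥0) => r • Complex.exp (z * (r : ℝ)))
    (bound := fun r : ℝ≥0 => (r : ℝ) * Real.exp (z.re / 2 * r))
    half_plane_mem (.of_forall fun w => by fun_prop) (integrable_cexp_mul_sub_one hν hz.le)
    (by fun_prop)
    (ae_of_all _ fun r w hw => by
      rw [NNReal.smul_def, norm_smul, Complex.norm_exp, Complex.re_mul_ofReal,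
        NNReal.norm_eq]
      gcongr
      exact le_of_lt hw)
    (integrable_mul_exp_mul hν (by linarith))
    (ae_of_all _ fun r w _ => by
      simpa [NNReal.smul_def, mul_comm] using
        ((hasDerivAt_id w).mul_const ((r : ℝ) : ℂ)).cexp.sub_const 1)).2
  rwa [← integral_withDensity_eq_integral_smul (f := fun r : ℝ≥0 => r)
    measurable_id] at hderiv

lemma continuousOn_levyExponent (hν : Integrable (fun r : ℝ≥0 => min 1 (r : ℝ)) ν) :
    ContinuousOn (levyExponent ν) {z | z.re ≤ 0} := by
  intro z hz
  have : ContinuousOn (levyExponent ν) ({z | z.re ≤ 0} ∩ Metric.ball z 1) := by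
    refine continuousOn_of_dominated (bound := fun r : ℝ≥0 => 2 * (1 + (‖z‖ + 1)) * min 1 (r : ℝ))
      (fun w _ => by fun_prop) (fun w hw => ae_of_all _ fun r => ?_) (hν.const_mul _)
      (ae_of_all _ fun r => by fun_prop)
    have norm_w_le : ‖w‖ ≤ ‖z‖ + 1 := by
      linarith [norm_sub_norm_le w z, mem_ball_iff_norm.1 hw.2]
    exact (norm_cexp_mul_sub_one_le hw.1 r.2).trans
      (mul_le_mul_of_nonneg_right (by linarith) (le_min zero_le_one r.2))
  exact (continuousWithinAt_inter (Metric.ball_mem_nhds z one_pos)).1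
    (this z ⟨hz, Metric.mem_ball_self one_pos⟩)

lemma re_levyExponent_nonpos (hν : Integrable (fun r : ℝ≥0 => min 1 (r : ℝ)) ν) {z : ℂ}
    (hz : z.re ≤ 0) : (levyExponent ν z).re ≤ 0 := by
  have re_integral : (levyExponent ν z).re = ∫ r, (Complex.exp (z * (r : ℝ)) - 1).re ∂ν :=
    (integral_re (integrable_cexp_mul_sub_one hν hz)).symm
  rw [re_integral]
  refine integral_nonpos fun r => ?_
  simpa using (Complex.re_le_norm _).trans (norm_cexp_mul_le_one hz r.2)

end LevyExponent

section LaplaceContinuation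

lemma eq_of_eq_on_imaginary_axis_of_bounded {f g : ℂ → ℂ} {C : ℝ}
    (hf : DifferentiableOn ℂ f {z | z.re < 0}) (hf_cont : ContinuousOn f {z | z.re ≤ 0})
    (hf_bound : ∀ z : ℂ, z.re ≤ 0 → ‖f z‖ ≤ C)
    (hg : DifferentiableOn ℂ g {z | z.re < 0}) (hg_cont : ContinuousOn g {z | z.re ≤ 0})
    (hg_bound : ∀ z : ℂ, z.re ≤ 0 → ‖g z‖ ≤ C)
    (h : ∀ u : ℝ, f (u * Complex.I) = g (u * Complex.I)) {z : ℂ} (hz : z.re ≤ 0) : f z = g z := by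
  set d : ℂ → ℂ := fun z => f (-z) - g (-z)
  have d_bound : ∀ w : ℂ, 0 ≤ w.re → ‖d w‖ ≤ 2 * C := fun w hw => by
    have hw' : (-w).re ≤ 0 := by simpa using hw
    linarith [norm_sub_le (f (-w)) (g (-w)), hf_bound _ hw', hg_bound _ hw']
  have d_diffContOnCl : DiffContOnCl ℂ d {w | 0 < w.re} := by
    refine ⟨?_, ?_⟩
    · exact (hf.sub hg).comp differentiableOn_id.neg fun w hw => by simpa using hw
    · rw [Complex.closure_setOfPred_lt_re]
      exact (hf_cont.sub hg_cont).comp continuousOn_neg fun w hw => by simpa using hw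
  have d_neg_le : ‖d (-z)‖ ≤ 0 := by
    refine PhragmenLindelof.right_half_plane_of_bounded_on_real d_diffContOnCl
      ⟨1, by norm_num, 0, .of_bound (2 * C) ?_⟩
      (isBoundedUnder_of_eventually_le (a := 2 * C) ?_) (fun u => ?_) (by simpa using hz)
    · filter_upwards [mem_inf_of_right (mem_principal_self _)] with w hw
      simpa using d_bound w (le_of_lt hw)
    · filter_upwards [eventually_ge_atTop 0] with x hx
      exact d_bound x (by simpa using hx)
    · have := h (-u)
      simp only [Complex.ofReal_neg, neg_mul] at this
      simp [d, this]
  simpa [d, sub_eq_zero] using d_neg_le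

variable {S : Type*} [MeasurableSpace S] {P : Measure S} {X : S → ℝ} {ν : Measure ℝ≥0}

lemma complexMGF_eq_cexp_levyExponent [IsProbabilityMeasure P] (hX : AEMeasurable X P)
    (hX_nonneg : ∀ s, 0 ≤ X s) (hν : Integrable (fun r : ℝ≥0 => min 1 (r : ℝ)) ν)
    (h : ∀ u : ℝ, complexMGF X P (u * Complex.I) =
      Complex.exp (levyExponent ν (u * Complex.I))) {z : ℂ} (hz : z.re ≤ 0) :
    complexMGF X P z = Complex.exp (levyExponent ν z) := by
  refine eq_of_eq_on_imaginary_axis_of_bounded (C := 1)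
    (differentiableOn_complexMGF.mono fun w hw =>
      Iio_subset_interior_integrableExpSet hX hX_nonneg hw) ?_ (fun w hw => ?_)
    (fun w hw => ((hasDerivAt_levyExponent hν hw).cexp).differentiableAt.differentiableWithinAt)
    (continuousOn_levyExponent hν).cexp (fun w hw => ?_) h hz
  · exact continuousOn_of_dominated (bound := fun _ => 1) (fun w _ => by fun_prop)
      (fun w hw => ae_of_all _ fun s => norm_cexp_mul_le_one hw (hX_nonneg s))
      (integrable_const 1) (ae_of_all _ fun s => by fun_prop)
  · simpa [complexMGF] using norm_integral_le_of_norm_le_const (μ := P)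
      (ae_of_all _ fun s => norm_cexp_mul_le_one hw (hX_nonneg s))
  · rw [Complex.norm_exp, Real.exp_le_one_iff]
    exact re_levyExponent_nonpos hν hw

lemma iteratedDeriv_complexMGF_neg_one (h : -1 ∈ interior (integrableExpSet X P)) (n : ℕ) :
    iteratedDeriv n (complexMGF X P) (-1) = ((∫ s, X s ^ n * Real.exp (-X s) ∂P : ℝ) : ℂ) := by
  rw [iteratedDeriv_complexMGF (by simpa using h), ← integral_complex_ofReal]
  simp

lemma integral_pow_mul_exp_sizeBiased (ν : Measure ℝ≥0) (n : ℕ) :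
    ∫ r : ℝ≥0, (r : ℝ) ^ n * Real.exp (-r) ∂sizeBiased ν = tiltedMoment ν (n + 1) := by
  rw [sizeBiased, integral_withDensity_eq_integral_smul (f := fun r : ℝ≥0 => r) measurable_id,
    tiltedMoment]
  simp only [NNReal.smul_def, smul_eq_mul, pow_succ']
  ring_nf

lemma integral_pow_succ_mul_exp_neg [IsProbabilityMeasure P] (hX : AEMeasurable X P)
    (hX_nonneg : ∀ s, 0 ≤ X s) (hν : Integrable (fun r : ℝ≥0 => min 1 (r : ℝ)) ν)
    (h : ∀ u : ℝ, complexMGF X P (u * Complex.I) =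
      Complex.exp (levyExponent ν (u * Complex.I))) (n : ℕ) :
    ∫ s, X s ^ (n + 1) * Real.exp (-X s) ∂P =
      ∑ j ∈ Finset.range (n + 1), n.choose j * (∫ s, X s ^ j * Real.exp (-X s) ∂P) *
        tiltedMoment ν (n - j + 1) := by
  have mem_X : (-1 : ℝ) ∈ interior (integrableExpSet X P) :=
    Iio_subset_interior_integrableExpSet hX hX_nonneg (by simp)
  have mem_ν := Iio_subset_interior_integrableExpSet_sizeBiased hν (show (-1 : ℝ) ∈ _ by simp)
  have deriv_eq : deriv (complexMGF X P) =ᶠ[𝓝 (-1)]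
      complexMGF X P * complexMGF (fun r : ℝ≥0 => (r : ℝ)) (sizeBiased ν) := by
    have open_half_plane : IsOpen {z : ℂ | z.re < 0} :=
      isOpen_lt Complex.continuous_re continuous_const
    have eqOn : Set.EqOn (complexMGF X P) (fun z => Complex.exp (levyExponent ν z))
        {z | z.re < 0} :=
      fun z hz => complexMGF_eq_cexp_levyExponent hX hX_nonneg hν h (le_of_lt hz)
    filter_upwards [open_half_plane.mem_nhds (show (-1 : ℂ) ∈ _ by simp)] with z hz
    rw [(eqOn.eventuallyEq_of_mem (open_half_plane.mem_nhds hz)).deriv_eq,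
      (hasDerivAt_levyExponent hν hz).cexp.deriv, Pi.mul_apply, eqOn hz]
  have leibniz := iteratedDeriv_mul (n := n)
    (analyticAt_complexMGF (z := -1) (by simpa using mem_X)).contDiffAt
    (analyticAt_complexMGF (z := -1) (by simpa using mem_ν)).contDiffAt
  rw [← deriv_eq.iteratedDeriv_eq, ← iteratedDeriv_succ'] at leibniz
  simp only [iteratedDeriv_complexMGF_neg_one mem_X, iteratedDeriv_complexMGF_neg_one mem_ν,
    integral_pow_mul_exp_sizeBiased] at leibniz
  exact_mod_cast leibniz

end LaplaceContinuation

section BellPolynomial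

open Polynomial

/-- The `n`-th complete Bell polynomial in `κ 1 * X, κ 2 * X, …`, i.e. the `n`-th moment of a law
whose cumulants are `κ j * X`. -/
noncomputable def bellPolynomial {R : Type*} [CommSemiring R] (κ : ℕ → R) : ℕ → R[X]
  | 0 => 1
  | n + 1 => X * ∑ j : Fin (n + 1), C (n.choose j * κ (n - j + 1)) * bellPolynomial κ j

variable {R : Type*} [CommSemiring R] (κ : ℕ → R)

lemma bellPolynomial_zero : bellPolynomial κ 0 = 1 := by
  rw [bellPolynomial]

lemma bellPolynomial_succ (n : ℕ) : bellPolynomial κ (n + 1) =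
    X * ∑ j ∈ Finset.range (n + 1), C (n.choose j * κ (n - j + 1)) * bellPolynomial κ j := by
  rw [bellPolynomial, Finset.sum_range]

lemma coeff_zero_bellPolynomial {n : ℕ} (hn : n ≠ 0) : (bellPolynomial κ n).coeff 0 = 0 := by
  obtain ⟨n, rfl⟩ := Nat.exists_eq_succ_of_ne_zero hn
  rw [bellPolynomial_succ, coeff_X_mul_zero]

lemma coeff_one_bellPolynomial {n : ℕ} (hn : n ≠ 0) : (bellPolynomial κ n).coeff 1 = κ n := by
  obtain ⟨n, rfl⟩ := Nat.exists_eq_succ_of_ne_zero hn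
  rw [bellPolynomial_succ, coeff_X_mul, finsetSum_coeff,
    Finset.sum_eq_single_of_mem 0 (by simp) fun j _ hj => by
      rw [coeff_C_mul, coeff_zero_bellPolynomial κ hj, mul_zero]]
  simp [bellPolynomial_zero]

lemma eval_bellPolynomial {n : ℕ} (hn : n ≠ 0) (c : R) :
    (bellPolynomial κ n).eval c = c * (bellPolynomial κ n).divX.eval c := by
  conv_lhs => rw [← divX_mul_X_add (bellPolynomial κ n), coeff_zero_bellPolynomial κ hn]
  simp [mul_comm]

lemma eval_zero_divX_bellPolynomial {n : ℕ} (hn : n ≠ 0) :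
    (bellPolynomial κ n).divX.eval 0 = κ n := by
  rw [← coeff_zero_eq_eval_zero, coeff_divX, zero_add, coeff_one_bellPolynomial κ hn]

lemma eq_mul_eval_bellPolynomial {κ : ℕ → R} {c : R} {M : ℕ → R}
    (hM : ∀ n, M (n + 1) =
      ∑ j ∈ Finset.range (n + 1), n.choose j * M j * (c * κ (n - j + 1))) (n : ℕ) :
    M n = M 0 * (bellPolynomial κ n).eval c := by
  induction n using Nat.strong_induction_on with
  | _ n ih =>
    cases n with
    | zero => simp [bellPolynomial_zero]
    | succ n =>
      rw [hM, bellPolynomial_succ, eval_mul, eval_X, eval_finsetSum, Finset.mul_sum,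
        Finset.mul_sum]
      refine Finset.sum_congr rfl fun j hj => ?_
      rw [ih j (Finset.mem_range.1 hj), eval_mul, eval_C]
      ring

end BellPolynomial

section SeparatingMaps

lemma exists_eventually_separating_maps (α : Type*) [MeasurableSpace α]
    [MeasurableSpace.CountablySeparated α] :
    ∃ φ : (N : ℕ) → α → Fin N → Bool, (∀ N, Measurable (φ N)) ∧
      ∀ x y, ∀ᶠ N in atTop, φ N x = φ N y ↔ x = y := by
  obtain ⟨f, hf, hf_inj⟩ :=
    MeasurableSpace.measurable_injection_nat_bool_of_countablySeparated (α := α)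
  refine ⟨fun N x j => f x j, fun N => by fun_prop, fun x y => ?_⟩
  rcases eq_or_ne x y with rfl | hxy
  · simp
  · obtain ⟨j, hj⟩ := Function.ne_iff.1 (hf_inj.ne hxy)
    filter_upwards [eventually_gt_atTop j] with N hN
    exact iff_of_false (fun h => hj (congrFun h ⟨j, hN⟩)) hxy

variable {α : Type*} {B : ℕ → Type*} {φ : (N : ℕ) → α → B N}

lemma eventually_ker_comp_eq (hφ_sep : ∀ x y, ∀ᶠ N in atTop, φ N x = φ N y ↔ x = y) {V : Type*}
    [Finite V] (ω : V → α) : ∀ᶠ N in atTop, Setoid.ker (φ N ∘ ω) = Setoid.ker ω := by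
  simp only [ker_eq_ker_iff, eventually_all]
  exact fun v w => hφ_sep (ω v) (ω w)

variable [MeasurableSpace α] [∀ N, MeasurableSpace (B N)] [∀ N, MeasurableSingletonClass (B N)]

lemma tendsto_measureReal_fiber (hφ : ∀ N, Measurable (φ N))
    (hφ_sep : ∀ x y, ∀ᶠ N in atTop, φ N x = φ N y ↔ x = y) (μ : Measure α) [IsFiniteMeasure μ]
    (x : α) : Tendsto (fun N => μ.real (φ N ⁻¹' {φ N x})) atTop (𝓝 (μ.real {x})) := by
  refine (ENNReal.tendsto_toReal (measure_ne_top μ _)).comp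
    (tendsto_measure_of_tendsto_indicator_of_isFiniteMeasure atTop μ
      (fun N => hφ N (measurableSet_singleton _)) fun y => ?_)
  simpa using hφ_sep y x

variable [∀ N, Finite (B N)] {V W : Type*} [Fintype V]

lemma tendsto_measure_pi_ker_comp_eq (hφ : ∀ N, Measurable (φ N))
    (hφ_sep : ∀ x y, ∀ᶠ N in atTop, φ N x = φ N y ↔ x = y) (μ : Measure α) [IsFiniteMeasure μ]
    (q : V → W) :
    Tendsto (fun N => Measure.pi (fun _ => μ) {ω : V → α | Setoid.ker (φ N ∘ ω) = Setoid.ker q})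
      atTop (𝓝 (Measure.pi (fun _ => μ) {ω : V → α | Setoid.ker ω = Setoid.ker q})) := by
  refine tendsto_measure_of_tendsto_indicator_of_isFiniteMeasure atTop _ (fun N => ?_) fun ω => ?_
  · exact measurable_pi_lambda (fun ω : V → α => φ N ∘ ω)
      (fun v => (hφ N).comp (measurable_pi_apply v))
      (Set.toFinite {a | Setoid.ker a = _}).measurableSet
  · filter_upwards [eventually_ker_comp_eq hφ_sep ω] with N hN
    simp only [hN]

end SeparatingMaps

section ProductMeasure

lemma measurableEq_of_countablySeparated (α : Type*) [MeasurableSpace α]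
    [MeasurableSpace.CountablySeparated α] : MeasurableEq α := by
  obtain ⟨f, hf, hf_inj⟩ :=
    MeasurableSpace.measurable_injection_nat_bool_of_countablySeparated (α := α)
  constructor
  have hdiag : Set.diagonal α = {p | f p.1 = f p.2} := by
    ext p
    exact hf_inj.eq_iff.symm
  exact hdiag ▸ measurableSet_eq_fun (hf.comp measurable_fst) (hf.comp measurable_snd)

variable {V α β : Type*} [Fintype V] [MeasurableSpace α]

lemma ae_pi_ne [MeasurableEq α] (μ : Measure α) [SigmaFinite μ] [NullSingletonClass μ] {v w : V}
    (hvw : v ≠ w) : ∀ᵐ ω ∂Measure.pi fun _ : V => μ, ω v ≠ ω w := by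
  classical
  have hmeas : MeasurableSet {ω : V → α | ω v = ω w} :=
    measurableSet_eq_fun (measurable_pi_apply v) (measurable_pi_apply w)
  have hslice (ω : V → α) : (fun x => {ω : V → α | ω v = ω w}.indicator (1 : (V → α) → ℝ≥0∞)
      (Function.update ω v x)) = Set.indicator {ω w} 1 := by
    ext x
    simp [Set.indicator_apply, Function.update_of_ne hvw.symm]
  have hmarginal : ∫⁻ ω, {ω : V → α | ω v = ω w}.indicator 1 ω ∂Measure.pi (fun _ => μ) =
      ∫⁻ _, 0 ∂Measure.pi fun _ : V => μ := by
    refine lintegral_eq_of_lmarginal_eq {v} (measurable_one.indicator hmeas) measurable_const ?_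
    funext ω
    simp only [lmarginal_singleton, hslice, lintegral_indicator_one (measurableSet_singleton _),
      measure_singleton, lintegral_zero]
  simpa [lintegral_indicator_one hmeas, ae_iff] using hmarginal

lemma ae_pi_injective [MeasurableEq α] (μ : Measure α) [SigmaFinite μ] [NullSingletonClass μ] :
    ∀ᵐ ω ∂Measure.pi fun _ : V => μ, Function.Injective ω := by
  have hne (p : {p : V × V // p.1 ≠ p.2}) : ∀ᵐ ω ∂Measure.pi fun _ : V => μ, ω p.1.1 ≠ ω p.1.2 :=
    ae_pi_ne μ p.2
  filter_upwards [ae_all_iff.2 hne] with ω hω v w hvw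
  by_contra h
  exact hω ⟨(v, w), h⟩ hvw

variable [MeasurableSpace β] [MeasurableSingletonClass β] {μ : Measure α}
  [IsFiniteMeasure μ] {φ : α → β}

lemma pi_map_comp_singleton (hφ : Measurable φ) (a : V → β) :
    (Measure.pi fun _ : V => μ).map (fun ω => φ ∘ ω) {a} = ∏ v, μ (φ ⁻¹' {a v}) := by
  have hmap := Measure.pi_map_pi (μ := fun _ : V => μ) fun _ => hφ.aemeasurable
  simp only [Function.comp_def, hmap, Measure.pi_singleton,
    Measure.map_apply hφ (measurableSet_singleton _)]

lemma pi_setOf_comp_mem (hφ : Measurable φ) (A : Finset (V → β)) :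
    Measure.pi (fun _ : V => μ) {ω | φ ∘ ω ∈ A} = ∑ a ∈ A, ∏ v, μ (φ ⁻¹' {a v}) := by
  have hcomp : Measurable fun ω : V → α => φ ∘ ω := by fun_prop
  simp only [← pi_map_comp_singleton hφ, sum_measure_singleton]
  rw [Measure.map_apply hcomp A.measurableSet]
  rfl

open Classical in
lemma integral_pi_comp [Fintype β] (hφ : Measurable φ) (F : (V → β) → ℝ) :
    ∫ ω, F (φ ∘ ω) ∂Measure.pi (fun _ : V => μ) = ∑ a, (∏ v, μ.real (φ ⁻¹' {a v})) * F a := by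
  have hcomp : Measurable fun ω : V → α => φ ∘ ω := by fun_prop
  rw [← integral_map hcomp.aemeasurable (by fun_prop), integral_fintype (.of_finite)]
  simp [measureReal_def, pi_map_comp_singleton hφ, ENNReal.toReal_prod]

end ProductMeasure

section PartitionSums

open Classical in
lemma sum_prod_card_fiber_eq_sum_injective {I V β R : Type*} [Fintype I] [Fintype V] [Fintype β]
    [CommSemiring R] {q : I → V} (hq : Function.Surjective q) {F : β → ℕ → R}
    (hF : ∀ b, F b 0 = 1) :
    ∑ a : I → β with Setoid.ker a = Setoid.ker q, ∏ b, F b (Finset.univ.filter (a · = b)).card =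
      ∑ a : V → β with Function.Injective a, ∏ v, F (a v) (Finset.univ.filter (q · = v)).card := by
  symm
  refine Finset.sum_nbij (· ∘ q) (fun a ha => ?_) (fun a _ a' _ h => hq.injective_comp_right h)
    (fun a ha => ?_) fun a ha => ?_
  · rw [Finset.mem_filter_univ] at ha
    simp only [Finset.mem_filter_univ, ker_eq_ker_iff]
    exact fun i j => ha.eq_iff
  · simp only [Finset.coe_filter_univ, Set.mem_ofPred_eq, ker_eq_ker_iff] at ha
    have ha_comp (i : I) : a (Function.surjInv hq (q i)) = a i :=
      (ha _ _).2 (Function.surjInv_eq hq _)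
    refine ⟨a ∘ Function.surjInv hq, ?_, funext ha_comp⟩
    simp only [Finset.coe_filter_univ, Set.mem_ofPred_eq]
    intro v w hvw
    simpa only [Function.surjInv_eq hq] using (ha _ _).1 hvw
  · rw [Finset.mem_filter_univ] at ha
    refine Finset.prod_of_injOn a ha.injOn (by simp) (fun b _ hb => ?_) fun v _ => ?_
    · have hempty : Finset.univ.filter (fun i => (a ∘ q) i = b) = ∅ :=
        Finset.filter_eq_empty_iff.2 fun i _ h => hb ⟨q i, by simp, h⟩
      simp only [hempty, Finset.card_empty, hF]
    · simp only [Function.comp_apply, ha.eq_iff]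

open Classical in
lemma tendsto_sum_injective_prod {V α : Type*} [Fintype V] [MeasurableSpace α] [MeasurableEq α]
    {B : ℕ → Type*} [∀ N, Fintype (B N)] [∀ N, MeasurableSpace (B N)]
    [∀ N, MeasurableSingletonClass (B N)] {φ : (N : ℕ) → α → B N} (hφ : ∀ N, Measurable (φ N))
    (hφ_sep : ∀ x y, ∀ᶠ N in atTop, φ N x = φ N y ↔ x = y) (μ : Measure α) [IsFiniteMeasure μ]
    [NullSingletonClass μ] {Q : V → ℝ → ℝ} (hQ : ∀ v, Continuous (Q v)) :
    Tendsto (fun N => ∑ a : V → B N with Function.Injective a,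
        ∏ v, μ.real (φ N ⁻¹' {a v}) * Q v (μ.real (φ N ⁻¹' {a v})))
      atTop (𝓝 (∏ v, μ.real Set.univ * Q v 0)) := by
  let F (N : ℕ) (a : V → B N) : ℝ :=
    if Function.Injective a then ∏ v, Q v (μ.real (φ N ⁻¹' {a v})) else 0
  have hsum (N : ℕ) : ∑ a : V → B N with Function.Injective a,
      ∏ v, μ.real (φ N ⁻¹' {a v}) * Q v (μ.real (φ N ⁻¹' {a v})) =
      ∫ ω, F N (φ N ∘ ω) ∂Measure.pi fun _ => μ := by
    rw [integral_pi_comp (hφ N)]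
    simp only [F, mul_ite, mul_zero, Finset.prod_mul_distrib, Finset.sum_filter]
  have hlim : ∏ v, μ.real Set.univ * Q v 0 = ∫ _, ∏ v, Q v 0 ∂Measure.pi fun _ : V => μ := by
    simp only [integral_const, measureReal_def, Measure.pi_univ, ENNReal.toReal_prod, smul_eq_mul,
      Finset.prod_mul_distrib]
  choose C hC using fun v => (isCompact_Icc (a := 0) (b := μ.real Set.univ)
    ).exists_bound_of_continuousOn (hQ v).continuousOn
  simp only [hsum, hlim]
  refine tendsto_integral_of_dominated_convergence (fun _ => ∏ v, |C v|) (fun N => ?_)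
    (integrable_const _) (fun N => ae_of_all _ fun ω => ?_) ?_
  · exact (Measurable.of_discrete.comp (g := F N) (f := fun (ω : V → α) v => φ N (ω v))
      (by fun_prop)).aestronglyMeasurable
  · simp only [F]
    split_ifs
    · rw [norm_prod]
      exact Finset.prod_le_prod (fun v _ => norm_nonneg _) fun v _ =>
        (hC v _ ⟨measureReal_nonneg, measureReal_mono (Set.subset_univ _)⟩).trans (le_abs_self _)
    · simpa using Finset.prod_nonneg fun v _ => abs_nonneg (C v)
  · filter_upwards [ae_pi_injective μ] with ω hω
    have hfiber (v : V) : Tendsto (fun N => μ.real (φ N ⁻¹' {φ N (ω v)})) atTop (𝓝 0) := by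
      simpa [measureReal_def] using tendsto_measureReal_fiber hφ hφ_sep μ (ω v)
    refine (tendsto_finsetProd _ fun v _ => ((hQ v).tendsto 0).comp (hfiber v)).congr' ?_
    filter_upwards [eventually_ker_comp_eq hφ_sep ω] with N hN
    have : Function.Injective (φ N ∘ ω) :=
      (Setoid.injective_iff_ker_bot _).2 (hN.trans ((Setoid.injective_iff_ker_bot _).1 hω))
    simp only [F, if_pos this, Function.comp_apply]

end PartitionSums

section FiniteMeasureFibers

variable {α β : Type*} [MeasurableSpace α] [Fintype β] [MeasurableSpace β]
  [MeasurableSingletonClass β] {φ : α → β} (μ : Measure α)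

lemma sum_measure_fiber (hφ : Measurable φ) : ∑ b, μ (φ ⁻¹' {b}) = μ Set.univ := by
  simpa using sum_measure_preimage_singleton (μ := μ) Finset.univ
    fun b _ => hφ (measurableSet_singleton b)

lemma prod_exp_neg_measureReal_fiber [IsFiniteMeasure μ] (hφ : Measurable φ) :
    ∏ b, Real.exp (-μ.real (φ ⁻¹' {b})) = Real.exp (-μ.real Set.univ) := by
  rw [← Real.exp_sum, Finset.sum_neg_distrib, measureReal_def, ← sum_measure_fiber μ hφ,
    ENNReal.toReal_sum fun b _ => measure_ne_top μ _]
  rfl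

open Classical in
lemma prod_pow_mul_exp_neg_measureReal_fiber [IsFiniteMeasure μ] (hφ : Measurable φ) {I : Type*}
    [Fintype I] (a : I → β) :
    ∏ b, (μ.real (φ ⁻¹' {b}) ^ (Finset.univ.filter (a · = b)).card *
      Real.exp (-μ.real (φ ⁻¹' {b}))) =
      Real.exp (-μ.real Set.univ) * ∏ i, μ.real (φ ⁻¹' {a i}) := by
  rw [Finset.prod_mul_distrib, prod_exp_neg_measureReal_fiber μ hφ, mul_comm,
    ← Finset.prod_fiberwise' Finset.univ a fun b => μ.real (φ ⁻¹' {b})]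
  simp only [Finset.prod_const]

end FiniteMeasureFibers

lemma pow_mul_exp_neg_le_factorial (n : ℕ) {x : ℝ} (hx : 0 ≤ x) :
    x ^ n * Real.exp (-x) ≤ n.factorial := by
  have h := Real.pow_div_factorial_le_exp x hx n
  rw [div_le_iff₀ (by positivity)] at h
  rw [Real.exp_neg, ← div_eq_mul_inv, div_le_iff₀ (Real.exp_pos x), mul_comm]
  exact h

lemma ofReal_exp_neg_mul_pi_le_factorial {α I : Type*} [MeasurableSpace α] [Fintype I]
    (μ : Measure α) [IsFiniteMeasure μ] (A : Set (I → α)) :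
    ENNReal.ofReal (Real.exp (-μ.real Set.univ)) * Measure.pi (fun _ => μ) A ≤
      (Fintype.card I).factorial := by
  calc ENNReal.ofReal (Real.exp (-μ.real Set.univ)) * Measure.pi (fun _ => μ) A
      ≤ ENNReal.ofReal (Real.exp (-μ.real Set.univ)) * Measure.pi (fun _ : I => μ) Set.univ := by
        gcongr
        exact Set.subset_univ A
    _ = ENNReal.ofReal (μ.real Set.univ ^ Fintype.card I * Real.exp (-μ.real Set.univ)) := by
        rw [Measure.pi_univ, Finset.prod_const, Finset.card_univ, mul_comm,
          ENNReal.ofReal_mul (by positivity), ENNReal.ofReal_pow measureReal_nonneg,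
          ofReal_measureReal]
    _ ≤ (Fintype.card I).factorial := by
        rw [← ENNReal.ofReal_natCast]
        exact ENNReal.ofReal_le_ofReal (pow_mul_exp_neg_le_factorial _ measureReal_nonneg)

lemma tiltedMoment_smul_measure (c : ℝ≥0∞) (ρ : Measure ℝ≥0) (n : ℕ) :
    tiltedMoment (c • ρ) n = c.toReal * tiltedMoment ρ n := by
  rw [tiltedMoment, integral_smul_measure, smul_eq_mul, tiltedMoment]

section CompletelyRandomMeasure

variable {S Ω : Type*} [MeasurableSpace S] [MeasurableSpace Ω] {ρ : Measure ℝ≥0} {G₀ : Measure Ω}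
  {P : Measure S} {G : S → Measure Ω}

lemma map_fst_prod_restrict [SFinite G₀] (A : Set Ω) :
    ((ρ.prod G₀).restrict (Set.univ ×ˢ A)).map Prod.fst = G₀ A • ρ := by
  ext s hs
  rw [Measure.map_apply measurable_fst hs, Measure.restrict_apply (measurable_fst hs),
    Set.univ_prod, ← Set.prod_eq, Measure.prod_prod, Measure.smul_apply, smul_eq_mul, mul_comm]

namespace IsCompletelyRandomMeasure

lemma measurable_apply {ν : Measure (ℝ≥0 × Ω)} (hG : IsCompletelyRandomMeasure ν P G) {A : Set Ω}
    (hA : MeasurableSet A) : Measurable fun s => G s A :=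
  (Measure.measurable_coe hA).comp hG.measurable

lemma ae_isFiniteMeasure {ν : Measure (ℝ≥0 × Ω)} (hG : IsCompletelyRandomMeasure ν P G) :
    ∀ᵐ s ∂P, IsFiniteMeasure (G s) :=
  hG.finite.mono fun _ hs => ⟨hs⟩

lemma integrable_min_one [SFinite G₀] (hG : IsCompletelyRandomMeasure (ρ.prod G₀) P G)
    (A : Set Ω) : Integrable (fun r : ℝ≥0 => min 1 (r : ℝ)) (G₀ A • ρ) := by
  rw [← map_fst_prod_restrict A, integrable_map_measure (by fun_prop) (by fun_prop)]
  refine Integrable.restrict ⟨by fun_prop, ?_⟩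
  change HasFiniteIntegral (fun p : ℝ≥0 × Ω => min 1 (p.1 : ℝ)) (ρ.prod G₀)
  rw [hasFiniteIntegral_iff_ofReal (ae_of_all _ fun p => le_min zero_le_one p.1.coe_nonneg)]
  refine (lintegral_congr fun p => ?_).trans_lt hG.levy
  rw [← ENNReal.ofReal_coe_nnreal, NNReal.coe_min, NNReal.coe_one]

lemma complexMGF_apply [SFinite G₀] (hG : IsCompletelyRandomMeasure (ρ.prod G₀) P G) {A : Set Ω}
    (hA : MeasurableSet A) (u : ℝ) :
    complexMGF (fun s => (G s).real A) P (u * Complex.I) =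
      Complex.exp (levyExponent (G₀ A • ρ) (u * Complex.I)) := by
  rw [levyExponent, ← map_fst_prod_restrict A,
    integral_map (by fun_prop) (by fun_prop), complexMGF]
  simp only [mul_comm (u : ℂ) Complex.I]
  exact hG.charFun A hA u

lemma integral_pow_mul_exp_neg [SFinite G₀] [IsProbabilityMeasure P]
    (hG : IsCompletelyRandomMeasure (ρ.prod G₀) P G) {A : Set Ω} (hA : MeasurableSet A) (n : ℕ) :
    ∫ s, (G s).real A ^ n * Real.exp (-(G s).real A) ∂P =
      (∫ s, Real.exp (-(G s).real A) ∂P) *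
        (bellPolynomial (tiltedMoment ρ) n).eval (G₀.real A) := by
  have hmeas : Measurable fun s => (G s).real A := (hG.measurable_apply hA).ennreal_toReal
  have hrec := integral_pow_succ_mul_exp_neg hmeas.aemeasurable (fun s => measureReal_nonneg)
    (hG.integrable_min_one A) (hG.complexMGF_apply hA)
  simp only [tiltedMoment_smul_measure] at hrec
  simpa [measureReal_def] using eq_mul_eval_bellPolynomial
    (M := fun n => ∫ s, (G s).real A ^ n * Real.exp (-(G s).real A) ∂P) hrec n

lemma measurable_prod_fiber {β I : Type*} [MeasurableSpace β] [MeasurableSingletonClass β]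
    [Fintype I] {φ : Ω → β} {ν : Measure (ℝ≥0 × Ω)} (hG : IsCompletelyRandomMeasure ν P G)
    (hφ : Measurable φ) (a : I → β) : Measurable fun s => ∏ i, G s (φ ⁻¹' {a i}) :=
  Finset.measurable_fun_prod _ fun _ _ => hG.measurable_apply (hφ (measurableSet_singleton _))

lemma iIndepFun_fiber {β : Type*} [Finite β] [MeasurableSpace β] [MeasurableSingletonClass β]
    {φ : Ω → β} {ν : Measure (ℝ≥0 × Ω)} (hG : IsCompletelyRandomMeasure ν P G)
    (hφ : Measurable φ) : iIndepFun (fun b s => G s (φ ⁻¹' {b})) P := by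
  have e := Finite.equivFin β
  have hdisjoint : Pairwise fun i j => Disjoint (φ ⁻¹' {e.symm i}) (φ ⁻¹' {e.symm j}) :=
    fun i j hij => Disjoint.preimage φ (Set.disjoint_singleton.2 (e.symm.injective.ne hij))
  simpa using (hG.indep _ (fun j => φ ⁻¹' {e.symm j}) (fun j => hφ (measurableSet_singleton _))
    hdisjoint).precomp e.injective

variable {β I V : Type*} [Fintype β] [Fintype I] [MeasurableSpace β]
  [MeasurableSingletonClass β] {φ : Ω → β}

open Classical in
lemma pi_ker_comp_eq_ae_eq_sum {ν : Measure (ℝ≥0 × Ω)} (hG : IsCompletelyRandomMeasure ν P G)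
    (hφ : Measurable φ) (q : I → V) :
    (fun s => Measure.pi (fun _ => G s) {ω : I → Ω | Setoid.ker (φ ∘ ω) = Setoid.ker q}) =ᵐ[P]
      fun s => ∑ a : I → β with Setoid.ker a = Setoid.ker q, ∏ i, G s (φ ⁻¹' {a i}) := by
  filter_upwards [hG.ae_isFiniteMeasure] with s hs
  rw [← pi_setOf_comp_mem hφ]
  simp only [Finset.mem_filter_univ]

variable [IsProbabilityMeasure P]

lemma integral_prod_pow_mul_exp_neg [SFinite G₀]
    (hG : IsCompletelyRandomMeasure (ρ.prod G₀) P G) (hφ : Measurable φ) (k : β → ℕ) :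
    ∫ s, ∏ b, ((G s).real (φ ⁻¹' {b}) ^ k b * Real.exp (-(G s).real (φ ⁻¹' {b}))) ∂P =
      (∫ s, Real.exp (-(G s).real Set.univ) ∂P) *
        ∏ b, (bellPolynomial (tiltedMoment ρ) (k b)).eval (G₀.real (φ ⁻¹' {b})) := by
  have hfiber (b : β) : MeasurableSet (φ ⁻¹' {b}) := hφ (measurableSet_singleton b)
  have hindep {f : β → ℝ → ℝ} (hf : ∀ b, Measurable (f b)) :
      ∫ s, ∏ b, f b ((G s).real (φ ⁻¹' {b})) ∂P = ∏ b, ∫ s, f b ((G s).real (φ ⁻¹' {b})) ∂P :=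
    (hG.iIndepFun_fiber hφ).integral_fun_prod_comp
      (fun b => (hG.measurable_apply (hfiber b)).aemeasurable)
      (fun b => ((hf b).comp ENNReal.measurable_toReal).aestronglyMeasurable)
  have hexp : ∏ b, ∫ s, Real.exp (-(G s).real (φ ⁻¹' {b})) ∂P =
      ∫ s, Real.exp (-(G s).real Set.univ) ∂P := by
    rw [← hindep (f := fun _ x => Real.exp (-x)) fun _ => by fun_prop]
    refine integral_congr_ae ?_
    filter_upwards [hG.ae_isFiniteMeasure] with s hs
    exact prod_exp_neg_measureReal_fiber (G s) hφ
  rw [hindep (f := fun b x => x ^ k b * Real.exp (-x)) fun b => by fun_prop]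
  simp only [← hexp, ← Finset.prod_mul_distrib, ← hG.integral_pow_mul_exp_neg (hfiber _)]

open Classical in
lemma lintegral_exp_neg_mul_prod_fiber [SFinite G₀]
    (hG : IsCompletelyRandomMeasure (ρ.prod G₀) P G) (hφ : Measurable φ) (a : I → β) :
    ∫⁻ s, ENNReal.ofReal (Real.exp (-(G s).real Set.univ)) * ∏ i, G s (φ ⁻¹' {a i}) ∂P =
      ENNReal.ofReal ((∫ s, Real.exp (-(G s).real Set.univ) ∂P) *
        ∏ b, (bellPolynomial (tiltedMoment ρ) (Finset.univ.filter (a · = b)).card).eval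
          (G₀.real (φ ⁻¹' {b}))) := by
  have hmeas (b : β) : Measurable fun s => (G s).real (φ ⁻¹' {b}) :=
    (hG.measurable_apply (hφ (measurableSet_singleton b))).ennreal_toReal
  rw [← hG.integral_prod_pow_mul_exp_neg hφ, ofReal_integral_eq_lintegral_ofReal]
  · refine lintegral_congr_ae ?_
    filter_upwards [hG.ae_isFiniteMeasure] with s hs
    rw [prod_pow_mul_exp_neg_measureReal_fiber (G s) hφ, ENNReal.ofReal_mul (Real.exp_nonneg _),
      ENNReal.ofReal_prod_of_nonneg fun i _ => measureReal_nonneg]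
    simp only [ofReal_measureReal (measure_ne_top (G s) _)]
  · refine Integrable.of_bound (by fun_prop)
      (∏ b, ((Finset.univ.filter (a · = b)).card.factorial : ℝ)) (ae_of_all _ fun s => ?_)
    rw [norm_prod]
    refine Finset.prod_le_prod (fun b _ => norm_nonneg _) fun b _ => ?_
    rw [Real.norm_of_nonneg (by positivity)]
    exact pow_mul_exp_neg_le_factorial _ measureReal_nonneg
  · exact ae_of_all _ fun s => Finset.prod_nonneg fun b _ => by positivity

variable [Fintype V]

open Classical in
lemma lintegral_exp_neg_mul_pi_ker_comp_eq [SFinite G₀]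
    (hG : IsCompletelyRandomMeasure (ρ.prod G₀) P G) (hφ : Measurable φ) {q : I → V}
    (hq : Function.Surjective q) :
    ∫⁻ s, ENNReal.ofReal (Real.exp (-(G s).real Set.univ)) *
        Measure.pi (fun _ => G s) {ω : I → Ω | Setoid.ker (φ ∘ ω) = Setoid.ker q} ∂P =
      ENNReal.ofReal ((∫ s, Real.exp (-(G s).real Set.univ) ∂P) *
        ∑ a : V → β with Function.Injective a, ∏ v,
          (bellPolynomial (tiltedMoment ρ) (Finset.univ.filter (q · = v)).card).eval
            (G₀.real (φ ⁻¹' {a v}))) := by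
  let A : Finset (I → β) := {a | Setoid.ker a = Setoid.ker q}
  have hmeas : Measurable fun s => (G s).real Set.univ :=
    (hG.measurable_apply .univ).ennreal_toReal
  have hprod := hG.measurable_prod_fiber (I := I) hφ
  calc _ = ∫⁻ s, ∑ a ∈ A, ENNReal.ofReal (Real.exp (-(G s).real Set.univ)) *
        ∏ i, G s (φ ⁻¹' {a i}) ∂P := by
        refine lintegral_congr_ae ?_
        filter_upwards [hG.pi_ker_comp_eq_ae_eq_sum hφ q] with s hs
        rw [hs, ← Finset.mul_sum]
    _ = ENNReal.ofReal (∑ a ∈ A, (∫ s, Real.exp (-(G s).real Set.univ) ∂P) *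
        ∏ b, (bellPolynomial (tiltedMoment ρ) (Finset.univ.filter (a · = b)).card).eval
          (G₀.real (φ ⁻¹' {b}))) := by
        rw [lintegral_finsetSum _ fun a _ => by fun_prop, ENNReal.ofReal_sum_of_nonneg]
        · exact Finset.sum_congr rfl fun a _ => hG.lintegral_exp_neg_mul_prod_fiber hφ a
        · intro a _
          rw [← hG.integral_prod_pow_mul_exp_neg hφ]
          positivity
    _ = _ := by
        rw [← Finset.mul_sum, sum_prod_card_fiber_eq_sum_injective hq
          (F := fun b k => (bellPolynomial (tiltedMoment ρ) k).eval (G₀.real (φ ⁻¹' {b})))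
          fun b => by simp [bellPolynomial_zero]]

open Classical in
lemma lintegral_exp_neg_mul_pi_ker_eq [MeasurableSpace.CountablySeparated Ω] [IsFiniteMeasure G₀]
    [NullSingletonClass G₀] (hG : IsCompletelyRandomMeasure (ρ.prod G₀) P G) {q : I → V}
    (hq : Function.Surjective q) :
    ∫⁻ s, ENNReal.ofReal (Real.exp (-(G s).real Set.univ)) *
        Measure.pi (fun _ => G s) {ω : I → Ω | Setoid.ker ω = Setoid.ker q} ∂P =
      ENNReal.ofReal ((∫ s, Real.exp (-(G s).real Set.univ) ∂P) *
        ∏ v, G₀.real Set.univ * tiltedMoment ρ (Finset.univ.filter (q · = v)).card) := by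
  have := measurableEq_of_countablySeparated Ω
  obtain ⟨φ, hφ, hφ_sep⟩ := exists_eventually_separating_maps Ω
  have hexp : Measurable fun s => ENNReal.ofReal (Real.exp (-(G s).real Set.univ)) :=
    (hG.measurable_apply .univ).ennreal_toReal.neg.exp.ennreal_ofReal
  have hfiber_ne (v : V) : (Finset.univ.filter (q · = v)).card ≠ 0 := by
    obtain ⟨i, rfl⟩ := hq v
    exact Finset.card_ne_zero.2 ⟨i, by simp⟩
  have hcells : Tendsto (fun N => ∫⁻ s, ENNReal.ofReal (Real.exp (-(G s).real Set.univ)) *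
      Measure.pi (fun _ => G s) {ω : I → Ω | Setoid.ker (φ N ∘ ω) = Setoid.ker q} ∂P) atTop
      (𝓝 (ENNReal.ofReal ((∫ s, Real.exp (-(G s).real Set.univ) ∂P) *
        ∏ v, G₀.real Set.univ * tiltedMoment ρ (Finset.univ.filter (q · = v)).card))) := by
    simp only [hG.lintegral_exp_neg_mul_pi_ker_comp_eq (hφ _) hq,
      eval_bellPolynomial _ (hfiber_ne _),
      ← eval_zero_divX_bellPolynomial (tiltedMoment ρ) (hfiber_ne _)]
    exact ENNReal.tendsto_ofReal ((tendsto_sum_injective_prod hφ hφ_sep G₀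
      fun v => Polynomial.continuous _).const_mul _)
  refine tendsto_nhds_unique (tendsto_lintegral_of_dominated_convergence'
    (fun _ => (Fintype.card I).factorial) (fun N => ?_) (fun N => ?_) (by simp) ?_) hcells
  · have hprod := hG.measurable_prod_fiber (I := I) (hφ N)
    exact hexp.aemeasurable.mul
      ((Finset.measurable_fun_sum _ fun a _ => hprod a).aemeasurable.congr
        (hG.pi_ker_comp_eq_ae_eq_sum (hφ N) q).symm)
  · filter_upwards [hG.ae_isFiniteMeasure] with s hs
    exact ofReal_exp_neg_mul_pi_le_factorial (G s) _
  · filter_upwards [hG.ae_isFiniteMeasure] with s hs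
    exact ENNReal.Tendsto.const_mul (tendsto_measure_pi_ker_comp_eq hφ hφ_sep (G s) q)
      (.inr ENNReal.ofReal_ne_top)

end IsCompletelyRandomMeasure

end CompletelyRandomMeasure

section LabelMeasure

variable {S Ω : Type*} [MeasurableSpace Ω]

/-- The random measure `∑ₖ rₖ δₖ` on the labels.  Normalised, it is the law of a label, and it is
carried to `G` by `k ↦ ωₖ`. -/
noncomputable def labelMeasure (r : ℕ → S → ℝ≥0) : S → Measure ℕ :=
  atomicMeasure r fun k _ => k

lemma labelMeasure_singleton (r : ℕ → S → ℝ≥0) (s : S) (k : ℕ) :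
    labelMeasure r s {k} = r k s :=
  Measure.sum_smul_dirac_singleton

lemma map_labelMeasure (r : ℕ → S → ℝ≥0) (loc : ℕ → S → Ω) (s : S) :
    (labelMeasure r s).map (fun k => loc k s) = atomicMeasure r loc s := by
  have hloc : Measurable fun k => loc k s := .of_discrete
  simp [labelMeasure, atomicMeasure, Measure.map_sum hloc.aemeasurable, Measure.map_dirac' hloc]

lemma labelMeasure_univ (r : ℕ → S → ℝ≥0) (loc : ℕ → S → Ω) (s : S) :
    labelMeasure r s Set.univ = atomicMeasure r loc s Set.univ := by
  rw [← map_labelMeasure, Measure.map_apply .of_discrete .univ, Set.preimage_univ]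

lemma isFiniteMeasure_labelMeasure (r : ℕ → S → ℝ≥0) (loc : ℕ → S → Ω) (s : S)
    [IsFiniteMeasure (atomicMeasure r loc s)] : IsFiniteMeasure (labelMeasure r s) :=
  ⟨labelMeasure_univ r loc s ▸ measure_lt_top (atomicMeasure r loc s) _⟩

lemma weight_le_totalMass (r : ℕ → S → ℝ≥0) (loc : ℕ → S → Ω) {s : S}
    [IsFiniteMeasure (atomicMeasure r loc s)] (k : ℕ) : r k s ≤ totalMass r loc s := by
  rw [← ENNReal.coe_le_coe, totalMass, ENNReal.coe_toNNReal (measure_ne_top _ _),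
    ← labelMeasure_singleton, ← labelMeasure_univ]
  exact measure_mono (Set.subset_univ _)

lemma tsum_prod_weight (r : ℕ → S → ℝ≥0) (s : S) [IsFiniteMeasure (labelMeasure r s)] {I : Type*}
    [Fintype I] (A : Set (I → ℕ)) :
    ∑' c : A, ∏ i, (r (c.1 i) s : ℝ≥0∞) = Measure.pi (fun _ => labelMeasure r s) A := by
  have hsum := tsum_measure_preimage_singleton (μ := Measure.pi fun _ : I => labelMeasure r s)
    A.to_countable (f := id) fun c _ => measurableSet_singleton c
  simpa [Measure.pi_singleton, labelMeasure_singleton] using hsum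

lemma measurableSet_ker_eq [MeasurableEq Ω] {I V : Type*} [Countable I] (q : I → V) :
    MeasurableSet {ω : I → Ω | Setoid.ker ω = Setoid.ker q} := by
  simp only [ker_eq_ker_iff, Set.ofPred_forall]
  refine .iInter fun i => .iInter fun j => ?_
  have hij : MeasurableSet {ω : I → Ω | ω i = ω j} :=
    measurableSet_eq_fun (measurable_pi_apply i) (measurable_pi_apply j)
  by_cases h : q i = q j
  · simpa only [h, iff_true] using hij
  · simp only [h, iff_false]
    exact hij.compl

lemma pi_labelMeasure_ker_eq [MeasurableEq Ω] {r : ℕ → S → ℝ≥0} {loc : ℕ → S → Ω} {s : S}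
    [IsFiniteMeasure (atomicMeasure r loc s)]
    (hdistinct : ∀ j k, 0 < r j s → 0 < r k s → loc j s = loc k s → j = k)
    {I V : Type*} [Fintype I] (q : I → V) :
    Measure.pi (fun _ => labelMeasure r s) {c : I → ℕ | Setoid.ker c = Setoid.ker q} =
      Measure.pi (fun _ => atomicMeasure r loc s) {ω : I → Ω | Setoid.ker ω = Setoid.ker q} := by
  have := isFiniteMeasure_labelMeasure r loc s
  have hloc : Measurable fun k => loc k s := .of_discrete
  have hpos : ∀ᵐ k ∂labelMeasure r s, 0 < r k s := by
    rw [ae_iff_of_countable]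
    intro k hk
    rw [labelMeasure_singleton] at hk
    exact_mod_cast pos_iff_ne_zero.2 hk
  have hpos_pi : ∀ᵐ c ∂Measure.pi fun _ : I => labelMeasure r s, ∀ i, 0 < r (c i) s :=
    ae_all_iff.2 fun i =>
      (Measure.tendsto_eval_ae_ae (μ := fun _ : I => labelMeasure r s)).eventually hpos
  simp only [← map_labelMeasure r loc s]
  rw [← Measure.pi_map_pi fun _ => hloc.aemeasurable,
    Measure.map_apply (by fun_prop) (measurableSet_ker_eq q)]
  refine measure_congr (hpos_pi.mono fun c hc => propext ?_)
  change Setoid.ker c = _ ↔ Setoid.ker (fun i => loc (c i) s) = _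
  simp only [ker_eq_ker_iff]
  exact forall₂_congr fun i j =>
    iff_congr ⟨congrArg (loc · s), hdistinct _ _ (hc i) (hc j)⟩ Iff.rfl

end LabelMeasure

lemma poissonMeasure_real_mul_prod_div {n : ℕ} {T : ℝ≥0} {w : Fin (n + 1) → ℝ≥0}
    (hw : ∀ i, w i ≤ T) :
    (poissonMeasure T).real {n + 1} * ∏ i, (w i : ℝ) / (T : ℝ) =
      ((n + 1).factorial : ℝ)⁻¹ * (Real.exp (-T) * ∏ i, (w i : ℝ)) := by
  rw [poissonMeasure_real_singleton]
  rcases eq_or_ne T 0 with rfl | hT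
  · simp [Fin.prod_univ_succ, le_antisymm (hw 0) zero_le]
  · rw [Finset.prod_div_distrib, Finset.prod_const, Finset.card_univ, Fintype.card_fin]
    field_simp

namespace IsCountMixture

variable {S Ω : Type*} [MeasurableSpace S] [MeasurableSpace Ω] {ρ : Measure ℝ≥0} {G₀ : Measure Ω}
  {P : Measure S} {r : ℕ → S → ℝ≥0} {loc : ℕ → S → Ω} {m : S → ℕ} {z : ℕ → S → ℕ}

lemma measurable_labels (h : IsCountMixture ρ G₀ P r loc m z) (n : ℕ) :
    Measurable fun s (i : Fin n) => z i s :=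
  measurable_pi_lambda _ fun i => h.measurable_label i

variable [IsProbabilityMeasure P]

lemma measure_size_inter_labels_eq (h : IsCountMixture ρ G₀ P r loc m z) {n : ℕ}
    (c : Fin n → ℕ) :
    P ((fun s (i : Fin n) => z i s) ⁻¹' {c} ∩ m ⁻¹' {n}) =
      ∫⁻ s, ENNReal.ofReal ((poissonMeasure (totalMass r loc s)).real {n} *
        ∏ i, (r (c i) s : ℝ) / (totalMass r loc s : ℝ)) ∂P := by
  have hset : {s | m s = n ∧ ∀ i : Fin n, z i s = c i} =
      (fun s (i : Fin n) => z i s) ⁻¹' {c} ∩ m ⁻¹' {n} := by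
    ext s
    simp [funext_iff, and_comm]
  have hmeas : MeasurableSet ((fun s (i : Fin n) => z i s) ⁻¹' {c} ∩ m ⁻¹' {n}) :=
    (h.measurable_labels n (measurableSet_singleton c)).inter
      (h.measurable_size (measurableSet_singleton n))
  have hsigma : atomSigma r loc ≤ ‹MeasurableSpace S› :=
    (measurable_pi_lambda _ fun k => (h.measurable_weight k).prodMk (h.measurable_loc k)).comap_le
  have hlaw := hset ▸ h.condLaw n c
  rw [← ofReal_integral_eq_lintegral_ofReal (integrable_condExp.congr hlaw)
    (ae_of_all _ fun s => by positivity), ← integral_congr_ae hlaw, integral_condExp hsigma,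
    integral_indicator_const _ hmeas, smul_eq_mul, mul_one, ofReal_measureReal]

lemma measure_labels_mem_inter_size (h : IsCountMixture ρ G₀ P r loc m z) {n : ℕ}
    (A : Set (Fin (n + 1) → ℕ)) :
    P ((fun s (i : Fin (n + 1)) => z i s) ⁻¹' A ∩ m ⁻¹' {n + 1}) =
      ENNReal.ofReal ((n + 1).factorial : ℝ)⁻¹ *
        ∫⁻ s, ENNReal.ofReal (Real.exp (-(atomicMeasure r loc s).real Set.univ)) *
          Measure.pi (fun _ => labelMeasure r s) A ∂P := by
  let C : ℝ≥0∞ := ENNReal.ofReal ((n + 1).factorial : ℝ)⁻¹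
  have hexp : Measurable fun s =>
      ENNReal.ofReal (Real.exp (-(atomicMeasure r loc s).real Set.univ)) :=
    (h.crm.measurable_apply .univ).ennreal_toReal.neg.exp.ennreal_ofReal
  have hweight (c : Fin (n + 1) → ℕ) : Measurable fun s => ∏ i, (r (c i) s : ℝ≥0∞) :=
    Finset.measurable_fun_prod _ fun i _ => (h.measurable_weight _).coe_nnreal_ennreal
  have hlabels (c : Fin (n + 1) → ℕ) :
      P ((fun s (i : Fin (n + 1)) => z i s) ⁻¹' {c} ∩ m ⁻¹' {n + 1}) =
        ∫⁻ s, C * (ENNReal.ofReal (Real.exp (-(atomicMeasure r loc s).real Set.univ)) *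
          ∏ i, (r (c i) s : ℝ≥0∞)) ∂P := by
    rw [h.measure_size_inter_labels_eq]
    refine lintegral_congr_ae ?_
    filter_upwards [h.crm.ae_isFiniteMeasure] with s hs
    rw [poissonMeasure_real_mul_prod_div fun i => weight_le_totalMass r loc (c i),
      ENNReal.ofReal_mul (by positivity), ENNReal.ofReal_mul (Real.exp_nonneg _),
      ENNReal.ofReal_prod_of_nonneg fun i _ => NNReal.coe_nonneg _]
    simp only [ENNReal.ofReal_coe_nnreal]
    rfl
  rw [← Measure.restrict_apply (h.measurable_labels _ .of_discrete),
    ← tsum_measure_preimage_singleton A.to_countable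
      fun c _ => h.measurable_labels _ (measurableSet_singleton c)]
  simp only [Measure.restrict_apply (h.measurable_labels _ (measurableSet_singleton _)), hlabels]
  rw [← lintegral_tsum fun c => by fun_prop, ← lintegral_const_mul' _ _ ENNReal.ofReal_ne_top]
  refine lintegral_congr_ae ?_
  filter_upwards [h.crm.ae_isFiniteMeasure] with s hs
  have := isFiniteMeasure_labelMeasure r loc s
  rw [ENNReal.tsum_mul_left, ENNReal.tsum_mul_left, tsum_prod_weight]

open Classical in
lemma measure_ker_labels_inter_size [MeasurableSpace.CountablySeparated Ω] [IsFiniteMeasure G₀]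
    [NullSingletonClass G₀] (h : IsCountMixture ρ G₀ P r loc m z) {n : ℕ} {V : Type*} [Fintype V]
    {q : Fin (n + 1) → V} (hq : Function.Surjective q) :
    P ({s | Setoid.ker (fun i : Fin (n + 1) => z i s) = Setoid.ker q} ∩ m ⁻¹' {n + 1}) =
      ENNReal.ofReal ((n + 1).factorial : ℝ)⁻¹ *
        ENNReal.ofReal ((∫ s, Real.exp (-(atomicMeasure r loc s).real Set.univ) ∂P) *
          ∏ v, G₀.real Set.univ * tiltedMoment ρ (Finset.univ.filter (q · = v)).card) := by
  have := measurableEq_of_countablySeparated Ω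
  refine (h.measure_labels_mem_inter_size {c | Setoid.ker c = Setoid.ker q}).trans ?_
  rw [← h.crm.lintegral_exp_neg_mul_pi_ker_eq hq]
  congr 1
  refine lintegral_congr_ae ?_
  filter_upwards [h.crm.ae_isFiniteMeasure, h.distinct] with s hs hdistinct
  rw [pi_labelMeasure_ker_eq hdistinct]

end IsCountMixture

section PartitionWeight

variable {ρ : Measure ℝ≥0} {γ : ℝ}

lemma integrable_pow_succ_mul_exp_neg (hρ : Integrable (fun r : ℝ≥0 => min 1 (r : ℝ)) ρ) (n : ℕ) :
    Integrable (fun r : ℝ≥0 => (r : ℝ) ^ (n + 1) * Real.exp (-(r : ℝ))) ρ := by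
  refine (hρ.const_mul ((n + 1).factorial : ℝ)).mono' (by fun_prop) (ae_of_all _ fun r => ?_)
  rw [Real.norm_of_nonneg (by positivity), mul_min_of_nonneg _ _ (by positivity), mul_one]
  refine le_min (pow_mul_exp_neg_le_factorial _ r.coe_nonneg) ?_
  calc (r : ℝ) ^ (n + 1) * Real.exp (-r) = (r : ℝ) ^ n * Real.exp (-r) * r := by ring
    _ ≤ (n + 1).factorial * r := by
      gcongr
      exact (pow_mul_exp_neg_le_factorial n r.coe_nonneg).trans
        (mod_cast Nat.factorial_le n.le_succ)

lemma tiltedMoment_nonneg (ρ : Measure ℝ≥0) (n : ℕ) : 0 ≤ tiltedMoment ρ n :=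
  integral_nonneg fun _ => by positivity

lemma tiltedMoment_succ_pos_iff (hρ : Integrable (fun r : ℝ≥0 => min 1 (r : ℝ)) ρ) (n : ℕ) :
    0 < tiltedMoment ρ (n + 1) ↔ 0 < ρ {0}ᶜ := by
  have hsupport : Function.support (fun r : ℝ≥0 => (r : ℝ) ^ (n + 1) * Real.exp (-(r : ℝ))) =
      {0}ᶜ := by
    ext r
    simp [Real.exp_ne_zero]
  rw [tiltedMoment, integral_pos_iff_support_of_nonneg (fun _ => by positivity)
    (integrable_pow_succ_mul_exp_neg hρ n), hsupport]

/-- The unnormalised exchangeable partition probability function of the model: every cluster of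
size `j` in the label vector `q` contributes a factor `γ * ∫ r^j e^{-r} ρ(dr)`. -/
noncomputable def partitionWeight (γ : ℝ) (ρ : Measure ℝ≥0) {n : ℕ} (q : Fin n → ℕ) : ℝ :=
  ∏ v ∈ Finset.univ.image q, γ * tiltedMoment ρ (clusterSize q v)

lemma partitionWeight_insertNth (hρ : ∀ j, 0 < tiltedMoment ρ (j + 1)) {n : ℕ} (i : Fin (n + 1))
    {y : Fin n → ℕ} (hy : Finset.univ.image y = Finset.Icc 1 (numClusters y)) {k : ℕ} (hk : 1 ≤ k) :
    partitionWeight γ ρ (i.insertNth (α := fun _ => ℕ) k y) =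
      partitionWeight γ ρ y * predictionWeight γ ρ y k := by
  have hmem : k ∈ Finset.univ.image y ↔ k ≤ numClusters y := by simp [hy, hk]
  have hother {s : Finset ℕ} (hs : k ∉ s) :
      ∏ v ∈ s, γ * tiltedMoment ρ (clusterSize (i.insertNth (α := fun _ => ℕ) k y) v) =
        ∏ v ∈ s, γ * tiltedMoment ρ (clusterSize y v) :=
    Finset.prod_congr rfl fun v hv => by
      rw [clusterSize_insertNth, if_neg (ne_of_mem_of_not_mem hv hs).symm, add_zero]
  have hself : clusterSize (i.insertNth (α := fun _ => ℕ) k y) k = clusterSize y k + 1 := by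
    rw [clusterSize_insertNth, if_pos rfl]
  rw [partitionWeight, image_insertNth, partitionWeight, predictionWeight]
  split_ifs with hk_old
  · have hk_mem := hmem.2 hk_old
    have hpos : tiltedMoment ρ (clusterSize y k) ≠ 0 := by
      rw [← Nat.sub_one_add_one (clusterSize_pos hk_mem).ne']
      exact (hρ _).ne'
    rw [Finset.insert_eq_of_mem hk_mem, ← Finset.mul_prod_erase _ _ hk_mem,
      ← Finset.mul_prod_erase _ _ hk_mem, hother (Finset.notMem_erase _ _), hself]
    field_simp
  · have hk_mem := hmem.not.2 hk_old
    have hsize : clusterSize y k = 0 :=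
      Finset.card_eq_zero.2 (Finset.filter_eq_empty_iff.2 fun j _ hj =>
        hk_mem (Finset.mem_image.2 ⟨j, Finset.mem_univ j, hj⟩))
    rw [Finset.prod_insert hk_mem, hother hk_mem, hself, hsize, zero_add, mul_comm]

lemma predictionWeight_pos (hγ : 0 < γ) (hρ : ∀ j, 0 < tiltedMoment ρ (j + 1)) {n : ℕ}
    {y : Fin n → ℕ} (hy : Finset.univ.image y = Finset.Icc 1 (numClusters y)) {k : ℕ}
    (hk : 1 ≤ k) : 0 < predictionWeight γ ρ y k := by
  rw [predictionWeight]
  split_ifs with hk_old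
  · have hk_mem : k ∈ Finset.univ.image y := hy ▸ Finset.mem_Icc.2 ⟨hk, hk_old⟩
    refine div_pos (hρ _) ?_
    rw [← Nat.sub_one_add_one (clusterSize_pos hk_mem).ne']
    exact hρ _
  · exact mul_pos hγ (hρ 0)

end PartitionWeight

lemma cond_preimage_singleton_toReal_eq_div_sum {α ι : Type*} [MeasurableSpace α]
    [MeasurableSpace ι] [MeasurableSingletonClass ι] {μ : Measure α} [IsFiniteMeasure μ]
    {B : Set α} (hB : MeasurableSet B) (hμB : μ B ≠ 0) {X : α → ι} (hX : Measurable X)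
    {I : Finset ι} (hXI : ∀ a ∈ B, X a ∈ I) {D : ℝ} {w : ι → ℝ}
    (h : ∀ k ∈ I, μ.real (X ⁻¹' {k} ∩ B) = D * w k) {k : ι} (hk : k ∈ I) :
    (μ[X ⁻¹' {k} | B]).toReal = w k / ∑ k' ∈ I, w k' := by
  have htotal : μ.real B = D * ∑ k' ∈ I, w k' := by
    have hsum := sum_measure_preimage_singleton (μ := μ.restrict B) I
      fun k _ => hX (measurableSet_singleton k)
    simp only [Measure.restrict_apply' hB, Set.inter_eq_right.2 (show B ⊆ X ⁻¹' I from hXI)] at hsum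
    rw [measureReal_def, ← hsum, ENNReal.toReal_sum fun k _ => measure_ne_top μ _, Finset.mul_sum]
    exact Finset.sum_congr rfl h
  have hD : D ≠ 0 := by
    rintro rfl
    rw [zero_mul, measureReal_eq_zero_iff] at htotal
    exact hμB htotal
  rw [cond_apply hB, ENNReal.toReal_mul, ENNReal.toReal_inv, Set.inter_comm, ← measureReal_def,
    ← measureReal_def, h k hk, htotal, inv_mul_eq_div, mul_div_mul_left _ _ hD]

namespace IsCountMixture

variable {S Ω : Type*} [MeasurableSpace S] [MeasurableSpace Ω]
  [MeasurableSpace.CountablySeparated Ω] {ρ : Measure ℝ≥0} {G₀ : Measure Ω} [IsFiniteMeasure G₀]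
  [NullSingletonClass G₀] {P : Measure S} [IsProbabilityMeasure P] {r : ℕ → S → ℝ≥0}
  {loc : ℕ → S → Ω} {m : S → ℕ} {z : ℕ → S → ℕ}

lemma measureReal_ker_labels_inter_size (h : IsCountMixture ρ G₀ P r loc m z) {n : ℕ}
    (q : Fin (n + 1) → ℕ) :
    P.real ({s | Setoid.ker (fun i : Fin (n + 1) => z i s) = Setoid.ker q} ∩ m ⁻¹' {n + 1}) =
      ((n + 1).factorial : ℝ)⁻¹ * (∫ s, Real.exp (-(atomicMeasure r loc s).real Set.univ) ∂P) *
        partitionWeight (G₀.real Set.univ) ρ q := by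
  let q' (i : Fin (n + 1)) : Finset.univ.image q := ⟨q i, Finset.mem_image_of_mem q (by simp)⟩
  have hq' : Function.Surjective q' := by
    rintro ⟨v, hv⟩
    obtain ⟨i, -, rfl⟩ := Finset.mem_image.1 hv
    exact ⟨i, rfl⟩
  have hker : Setoid.ker q' = Setoid.ker q :=
    ker_eq_ker_iff.2 fun i j => Subtype.ext_iff
  have hprob := h.measure_ker_labels_inter_size hq'
  rw [hker] at hprob
  rw [measureReal_def, hprob, ENNReal.toReal_mul, ENNReal.toReal_ofReal (by positivity),
    ENNReal.toReal_ofReal (mul_nonneg (by positivity) (Finset.prod_nonneg fun v _ =>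
      mul_nonneg measureReal_nonneg (tiltedMoment_nonneg ρ _))), mul_assoc, partitionWeight,
    ← Finset.prod_coe_sort _ fun v => G₀.real Set.univ * tiltedMoment ρ (clusterSize q v)]
  refine congrArg _ (congrArg _ (Finset.prod_congr rfl fun v _ => ?_))
  rw [clusterSize]
  congr! 4 with i
  exact Subtype.ext_iff

lemma pos_of_measure_size_ne_zero (h : IsCountMixture ρ G₀ P r loc m z) {n : ℕ}
    (hm : P (m ⁻¹' {n + 1}) ≠ 0) :
    0 < G₀.real Set.univ ∧ ∀ j, 0 < tiltedMoment ρ (j + 1) := by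
  obtain ⟨q, hq⟩ : ∃ q : Fin (n + 1) → ℕ,
      P ((fun s (i : Fin (n + 1)) => z i s) ⁻¹' {q} ∩ m ⁻¹' {n + 1}) ≠ 0 := by
    by_contra! hnull
    refine hm (measure_mono_null ?_ (measure_iUnion_null hnull))
    exact fun s hs => Set.mem_iUnion.2 ⟨fun i => z i s, rfl, hs⟩
  have hweight : partitionWeight (G₀.real Set.univ) ρ q ≠ 0 := by
    refine right_ne_zero_of_mul ((h.measureReal_ker_labels_inter_size q).symm.trans_ne ?_)
    refine (measureReal_ne_zero_iff (measure_ne_top P _)).2 (mt (measure_mono_null ?_) hq)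
    exact Set.inter_subset_inter_left _ fun s hs => congrArg Setoid.ker hs
  have hfactor := Finset.prod_ne_zero_iff.1 hweight (q 0) (Finset.mem_image_of_mem q (by simp))
  have hG₀ : 0 < G₀.real Set.univ := measureReal_nonneg.lt_of_ne' (left_ne_zero_of_mul hfactor)
  have hρ : Integrable (fun r : ℝ≥0 => min 1 (r : ℝ)) ρ :=
    (integrable_smul_measure (ENNReal.toReal_pos_iff.1 hG₀).1.ne' (measure_ne_top G₀ _)).1
      (h.crm.integrable_min_one Set.univ)
  have hsize : clusterSize q (q 0) - 1 + 1 = clusterSize q (q 0) :=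
    Nat.sub_one_add_one (clusterSize_pos (Finset.mem_image_of_mem q (by simp))).ne'
  have hmoment := (tiltedMoment_nonneg ρ _).lt_of_ne' (right_ne_zero_of_mul hfactor)
  rw [← hsize, tiltedMoment_succ_pos_iff hρ] at hmoment
  exact ⟨hG₀, fun j => (tiltedMoment_succ_pos_iff hρ j).2 hmoment⟩

lemma measureReal_labelOf_inter_labelsWithout (h : IsCountMixture ρ G₀ P r loc m z)
    (hρ : ∀ j, 0 < tiltedMoment ρ (j + 1)) {n : ℕ} (i : Fin (n + 1)) {y : Fin n → ℕ}
    (hy : appearanceLabel y = y) {k : ℕ} (hk : k ∈ Finset.Icc 1 (numClusters y + 1)) :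
    P.real ((fun s => labelOf i fun j => z j s) ⁻¹' {k} ∩
        {s | labelsWithout i (fun j => z j s) = y ∧ m s = n + 1}) =
      ((n + 1).factorial : ℝ)⁻¹ * (∫ s, Real.exp (-(atomicMeasure r loc s).real Set.univ) ∂P) *
        partitionWeight (G₀.real Set.univ) ρ y * predictionWeight (G₀.real Set.univ) ρ y k := by
  have hevent : (fun s => labelOf i fun j => z j s) ⁻¹' {k} ∩
      {s | labelsWithout i (fun j => z j s) = y ∧ m s = n + 1} =
      {s | Setoid.ker (fun j : Fin (n + 1) => z j s) =
        Setoid.ker (i.insertNth (α := fun _ => ℕ) k y)} ∩ m ⁻¹' {n + 1} := by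
    ext s
    simp only [← labelsWithout_eq_and_labelOf_eq_iff hy hk, Set.mem_inter_iff, Set.mem_preimage,
      Set.mem_singleton_iff, Set.mem_ofPred_eq]
    tauto
  have himage : Finset.univ.image y = Finset.Icc 1 (numClusters y) := by
    simpa only [hy] using image_appearanceLabel y
  rw [hevent, h.measureReal_ker_labels_inter_size,
    partitionWeight_insertNth hρ i himage (Finset.mem_Icc.1 hk).1, mul_assoc _ (partitionWeight ..)]

end IsCountMixture

end CountMixture

open CountMixture in
theorem mainTheorem4 {S Ω : Type*} [MeasurableSpace S] [MeasurableSpace Ω]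
    [MeasurableSpace.CountablySeparated Ω]
    (P : Measure S) [IsProbabilityMeasure P]
    (ρ : Measure ℝ≥0) (G₀ : Measure Ω) [IsFiniteMeasure G₀] [NullSingletonClass G₀]
    (r : ℕ → S → ℝ≥0) (loc : ℕ → S → Ω) (m : S → ℕ) (z : ℕ → S → ℕ)
    (h : CountMixture.IsCountMixture ρ G₀ P r loc m z)
    (n : ℕ) (i : Fin (n + 1)) (y : Fin n → ℕ)
    (hy : P {s | CountMixture.labelsWithout i (fun j => z j s) = y ∧ m s = n + 1} ≠ 0) :
    (∀ k ∈ Finset.Icc 1 (CountMixture.numClusters y + 1),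
      0 < CountMixture.predictionWeight (G₀.real Set.univ) ρ y k) ∧
    ∀ k ∈ Finset.Icc 1 (CountMixture.numClusters y + 1),
      (P[{s | CountMixture.labelOf i (fun j => z j s) = k} |
          {s | CountMixture.labelsWithout i (fun j => z j s) = y ∧ m s = n + 1}]).toReal =
        CountMixture.predictionWeight (G₀.real Set.univ) ρ y k /
          ∑ k' ∈ Finset.Icc 1 (CountMixture.numClusters y + 1),
            CountMixture.predictionWeight (G₀.real Set.univ) ρ y k' := by
  have hlabels : Measurable fun s (j : Fin (n + 1)) => z j s := h.measurable_labels (n + 1)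
  have hlabelOf : Measurable fun s => labelOf i fun j => z j s :=
    (Measurable.of_discrete (f := labelOf i)).comp hlabels
  have hmeas : MeasurableSet {s | labelsWithout i (fun j => z j s) = y ∧ m s = n + 1} :=
    (hlabels (.of_discrete (s := labelsWithout i ⁻¹' {y}))).inter
      (h.measurable_size (measurableSet_singleton (n + 1)))
  obtain ⟨s, rfl, -⟩ := nonempty_of_measure_ne_zero hy
  have hy_canonical := appearanceLabel_labelsWithout i fun j => z j s
  have himage := image_appearanceLabel (labelsWithout i fun j => z j s)
  rw [hy_canonical] at himage
  obtain ⟨hγ, hρ⟩ := h.pos_of_measure_size_ne_zero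
    (mt (measure_mono_null fun _ hs => hs.2) hy)
  refine ⟨fun k hk => predictionWeight_pos hγ hρ himage (Finset.mem_Icc.1 hk).1, fun k hk => ?_⟩
  exact cond_preimage_singleton_toReal_eq_div_sum hmeas hy hlabelOf
    (fun s hs => hs.1 ▸ labelOf_mem_Icc i _)
    (fun k hk => h.measureReal_labelOf_inter_labelsWithout hρ i hy_canonical hk) hk
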